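/- Let $p(x)=x^d+q(x)$ be a monic complex polynomial of degree $d\ge 2$ with $\deg q<d$, and let $f_a(x,y)=(p(x)-ay,\,x)$. Fix $0<r<1$, $R>0$ and $\alpha>0$ such that $\left|q(y)/y^d\right|+(R+1)/|y|^{d-1}<r$ and $|p(y)|>(2R+1)|y|$ whenever $|y|\ge\alpha$, and put $V_+=\{|x|>|y|,\ |x|>\alpha\}$, $V_-=\{|y|>|x|,\ |y|>\alpha\}$. Let $|a|<R$, and write $(x_k,y_k)=f_a^{k}(x,y)$. Define $$\varphi_+(x,y)=x\exp\Bigl(\sum_{k\ge1}d^{-k}\log\frac{x_k}{x_{k-1}^d}\Bigr)\ \text{ on } V_+,\qquad \varphi_-(x,y)=y\exp\Bigl(\sum_{k\ge1}d^{-k}\log\frac{a\,y_{-k}}{y_{-(k-1)}^d}\Bigr)\ \text{ on } V_-$$ (principal branch of $\log$; for $a=0$ the arguments of the logarithms in $\varphi_-$ are replaced by their limits as $a\to0$). The powers $\varphi_+^{d^n}=\varphi_+\circ f_a^n$ on $f_a^{-n}(V_+)$, and, for $k\ge 1$, $\varphi_-^{d^k}=a^{1+d+\dots+d^{k-1}}\varphi_-\circ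 f_a^{-k}$ on $f_a^k(V_-)$ (for $a=0$: $\varphi_-^{d^k}=(p(y)-x)^{d^{k-1}}$ on $\{x\ne p(y)\}$), are single-valued. They extend the foliations by the fibres of $\varphi_\pm$ to the unions $U_a^\pm$ of these sets; the critical locus $\mathcal C_a\subset U_a^+\cap U_a^-$ is the locus where the two foliations are tangent, i.e. where $d\log\varphi_+\wedge d\log\varphi_-=0$. In $\mathbb P^1\times\mathbb P^1$ use the coordinates $(u,y)$ with $u=1/x$, and let $\hat\Omega_a$ be the union of the line $\{u=0\}$ (with $y$ finite) and the set of $(x,y)\in V_+$ with $(x,y)\in f_a(V_-)$ (for $a=0$: with $x\neq p(y)$). Extend $\varphi_+^{-1}$ and $\varphi_-^{-d}$ to $\hat\Omega_a$ by $0$ on $u=0$. Then there is a holomorphic function $w_a$ on $\hat\Omega_a$ with $$d\varphi_+^{-1}\wedge d\varphi_-^{-d}=u^2\,w_a(u,y)\,du\wedge dy ,$$ it is unique, and off $u=0$ its zero set is $\mathcal C_a\cap\hat\Omega_a$. The extension of $\mathcal C_a$ to $\hat\Omega_a$, again denoted $\mathcal C_a$, is the zero set of $w_a$. For every simple critical point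 $c$ of $p$ (that is, $p'(c)=0\neq p''(c)$): 1. near $(u,y)=(0,c)$ one has $w_a(u,y)=-p'(y)-u\,H(u,y)$ with $H$ holomorphic; 2. the extended critical locus $\mathcal C_a$ passes through $(u,y)=(0,c)$ and is smooth there: $w_a(0,c)=0$ and $dw_a(0,c)\ne0$; 3. $\varphi_+^{-1}|_{\mathcal C_a}$ is a local biholomorphism at $(0,c)$: it is the restriction of a function holomorphic near $(0,c)$, and it maps a neighbourhood of $(0,c)$ in $\mathcal C_a$ bijectively onto an open subset of $\mathbb C$, with holomorphic inverse. -/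

import Mathlib

open Polynomial

noncomputable section

/-- The Hénon map `f_a(x, y) = (p(x) - a y, x)`. -/
def henon (p : ℂ[X]) (a : ℂ) (z : ℂ × ℂ) : ℂ × ℂ := (p.eval z.1 - a * z.2, z.1)

/-- The inverse `f_a⁻¹(x, y) = (y, (p(y) - x) / a)`; only meaningful (and only used) for `a ≠ 0`. -/
def henonInv (p : ℂ[X]) (a : ℂ) (z : ℂ × ℂ) : ℂ × ℂ := (z.2, (p.eval z.2 - z.1) / a)

/-- The constants `0 < r < 1`, `R > 0`, `α > 0` are admissible for `p = X ^ d + q` if, whenever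
`|y| ≥ α`, `|q(y) / y ^ d| + (R + 1) / |y| ^ (d - 1) < r` and `|p(y)| > (2 R + 1) |y|`. -/
structure HenonAdmissible (p : ℂ[X]) (r R α : ℝ) : Prop where
  r_pos : 0 < r
  r_lt_one : r < 1
  R_pos : 0 < R
  alpha_pos : 0 < α
  tail_lt : ∀ y : ℂ, α ≤ ‖y‖ →
    ‖(p - X ^ p.natDegree).eval y / y ^ p.natDegree‖ + (R + 1) / ‖y‖ ^ (p.natDegree - 1) < r
  growth : ∀ y : ℂ, α ≤ ‖y‖ → (2 * R + 1) * ‖y‖ < ‖p.eval y‖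

/-- The domain `V₊`. -/
def henonVPlus (α : ℝ) : Set (ℂ × ℂ) := {z | ‖z.2‖ < ‖z.1‖ ∧ α < ‖z.1‖}

/-- The domain `V₋`. -/
def henonVMinus (α : ℝ) : Set (ℂ × ℂ) := {z | ‖z.1‖ < ‖z.2‖ ∧ α < ‖z.2‖}

/-- `φ₊` on `V₊`: with `(x_k, y_k) = f_a^k(x, y)`,
`φ₊(x, y) = x * exp (∑_{k ≥ 1} d⁻ᵏ log (x_k / x_{k-1} ^ d))`, principal branch of `log`.
On `V₊` the series converges absolutely. -/
def phiPlus (p : ℂ[X]) (a : ℂ) (z : ℂ × ℂ) : ℂ :=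
  z.1 * Complex.exp (∑' k : ℕ, (1 / (p.natDegree : ℂ) ^ (k + 1)) *
    Complex.log (((henon p a)^[k + 1] z).1 / ((henon p a)^[k] z).1 ^ p.natDegree))

/-- The ratio `a y_{-(k+1)} / y_{-k} ^ d`, where `(x_{-k}, y_{-k}) = f_a^{-k}(x, y)`. At `a = 0` it
is the holomorphic continuation in `a`: `(p(y) - x) / y ^ d` for `k = 0` and `1` for `k ≥ 1`. -/
def henonBackRatio (p : ℂ[X]) (a : ℂ) (z : ℂ × ℂ) (k : ℕ) : ℂ :=
  if a = 0 then
    (if k = 0 then (p.eval z.2 - z.1) / z.2 ^ p.natDegree else 1)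
  else
    a * ((henonInv p a)^[k + 1] z).2 / ((henonInv p a)^[k] z).2 ^ p.natDegree

/-- `φ₋` on `V₋`:
`φ₋(x, y) = y * exp (∑_{k ≥ 1} d⁻ᵏ log (a y_{-k} / y_{-(k-1)} ^ d))`, principal branch of `log`.
On `V₋` the series converges absolutely. -/
def phiMinus (p : ℂ[X]) (a : ℂ) (z : ℂ × ℂ) : ℂ :=
  z.2 * Complex.exp (∑' k : ℕ, (1 / (p.natDegree : ℂ) ^ (k + 1)) *
    Complex.log (henonBackRatio p a z k))

/-- The domain on which `φ₋ ^ (d ^ (k + 1))` is single valued: `f_a^{k+1}(V₋)` if `a ≠ 0`, and the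
complement of the curve `x = p(y)` if `a = 0`. -/
def phiMinusPowDomain (p : ℂ[X]) (α : ℝ) (a : ℂ) (k : ℕ) : Set (ℂ × ℂ) :=
  {z | if a = 0 then p.eval z.2 ≠ z.1 else (henonInv p a)^[k + 1] z ∈ henonVMinus α}

/-- The extension of `φ₋ ^ (d ^ (k + 1))` to `phiMinusPowDomain`:
`a ^ (1 + d + ⋯ + d ^ k) * φ₋(f_a^{-(k+1)}(x, y))` if `a ≠ 0`, and `(p(y) - x) ^ (d ^ k)` if
`a = 0`. -/
def phiMinusPow (p : ℂ[X]) (a : ℂ) (k : ℕ) (z : ℂ × ℂ) : ℂ :=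
  if a = 0 then (p.eval z.2 - z.1) ^ (p.natDegree ^ k)
  else a ^ (∑ i ∈ Finset.range (k + 1), p.natDegree ^ i) * phiMinus p a ((henonInv p a)^[k + 1] z)

/-- The coefficient `h` in `dg₁ ∧ dg₂ = h ds ∧ dt`, where `(s, t)` are the coordinates. -/
def wedgeCoeff (g₁ g₂ : ℂ × ℂ → ℂ) (z : ℂ × ℂ) : ℂ :=
  fderiv ℂ g₁ z (1, 0) * fderiv ℂ g₂ z (0, 1) - fderiv ℂ g₂ z (1, 0) * fderiv ℂ g₁ z (0, 1)

/-- The critical locus `C_a` in `ℂ²`: the set of points of `U₊ ∩ U₋` at which the foliations defined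
by `φ₊` and `φ₋` are tangent. The foliations are continued from `V₊` and `V₋` by the dynamics:
`U₊` is the union of the sets `f_a^{-n}(V₊)`, on which the foliation is given by `φ₊ ∘ f_a^n`,
and `U₋` is the union of the sets `phiMinusPowDomain`, on which it is given by `phiMinusPow`. -/
def critLocus (p : ℂ[X]) (α : ℝ) (a : ℂ) : Set (ℂ × ℂ) :=
  {z | ∃ n k : ℕ, (henon p a)^[n] z ∈ henonVPlus α ∧ z ∈ phiMinusPowDomain p α a k ∧
    wedgeCoeff (phiPlus p a ∘ (henon p a)^[n]) (phiMinusPow p a k) z = 0}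

/-! In the following, points of `(ℙ¹ \ {0}) × ℂ ⊆ ℙ¹ × ℙ¹` are written in the coordinates
`(u, y)`, `u = 1 / x`; the line `x = ∞` is `u = 0`. -/

/-- The intersection of `V₊ ∪ {x = ∞}` and `f_a(V₋ ∪ {y = ∞})` (without the point `(∞, ∞)`),
in the coordinates `(u, y)`. For `a = 0` the second set is the union of `{x ≠ p(y)}` and the line
`x = ∞`. Since `f_a` maps `(x, ∞)` to `(∞, x)`, the whole line `u = 0` belongs to it. -/
def critDomainAtInfinity (p : ℂ[X]) (α : ℝ) (a : ℂ) : Set (ℂ × ℂ) :=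
  {z | z.1 = 0 ∨ ((z.1⁻¹, z.2) ∈ henonVPlus α ∧ (z.1⁻¹, z.2) ∈ phiMinusPowDomain p α a 0)}

/-- `φ₊⁻¹` in the coordinates `(u, y)`, extended by `0` to `u = 0`. -/
def phiPlusInv (p : ℂ[X]) (a : ℂ) (z : ℂ × ℂ) : ℂ :=
  if z.1 = 0 then 0 else (phiPlus p a (z.1⁻¹, z.2))⁻¹

/-- `φ₋^{-d}` in the coordinates `(u, y)`, extended by `0` to `u = 0`. -/
def phiMinusPowInv (p : ℂ[X]) (a : ℂ) (z : ℂ × ℂ) : ℂ :=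
  if z.1 = 0 then 0 else (phiMinusPow p a 0 (z.1⁻¹, z.2))⁻¹

/-- `w` is the holomorphic function with `dφ₊⁻¹ ∧ dφ₋^{-d} = u² w du ∧ dy` on
`critDomainAtInfinity`. Its zero set, with multiplicities, is by definition the extension of
`C_a` to this domain. -/
structure IsCritDefiningFunction (p : ℂ[X]) (α : ℝ) (a : ℂ) (w : ℂ × ℂ → ℂ) : Prop where
  holomorphic : DifferentiableOn ℂ w (critDomainAtInfinity p α a)
  wedge_eq : ∀ z ∈ critDomainAtInfinity p α a,
    wedgeCoeff (phiPlusInv p a) (phiMinusPowInv p a) z = z.1 ^ 2 * w z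

/-- The zero set of `w` in `critDomainAtInfinity`. -/
def critZeroSet (p : ℂ[X]) (α : ℝ) (a : ℂ) (w : ℂ × ℂ → ℂ) : Set (ℂ × ℂ) :=
  {z | z ∈ critDomainAtInfinity p α a ∧ w z = 0}

/-- The restriction of `g` to `C ⊆ ℂ²` is a local biholomorphism at `z ∈ C`: near `z`, the function
`g` is holomorphic and maps `C` bijectively onto an open subset of `ℂ`, with holomorphic inverse. -/
def IsLocalBiholomorphismOnAt (g : ℂ × ℂ → ℂ) (C : Set (ℂ × ℂ)) (z : ℂ × ℂ) : Prop :=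
  z ∈ C ∧ ∃ (N : Set (ℂ × ℂ)) (D : Set ℂ) (s : ℂ → ℂ × ℂ),
    IsOpen N ∧ z ∈ N ∧ IsOpen D ∧ DifferentiableOn ℂ g N ∧ DifferentiableOn ℂ s D ∧
    Set.MapsTo g (C ∩ N) D ∧ Set.MapsTo s D (C ∩ N) ∧ Set.InvOn s g (C ∩ N) D

end

/-! Both Böttcher coordinates come from one family. The maps `(x, y) ↦ ((p(x) - c y) / b, x)`
include `f_a` (`b = 1`, `c = a`) and, after swapping the coordinates, `f_a⁻¹` (`b = a`, `c = 1`). In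
the coordinates `u = 1 / x`, `s = y / x` they are holomorphic on a bidisc containing points at
infinity, also for `b = 0`, and contract `u = 0` to the origin. The logarithmic series therefore
sums to a holomorphic function vanishing on `u = 0`, hence divisible by `u`
(`differentiableOn_bottcherLog`, `exists_bottcherLog_eq_fst_mul`). Consequently `φ₊⁻¹ = u X` and
`φ₋^{-d} = u Y` with `X = exp(-u A)`, `Y = m exp(-u B)`, `m = 1 / (u p(y) - 1)`, and `∂X/∂y = u P`,
`∂Y/∂y = u Q` (`exists_factorization`). Expanding `d(uX) ∧ d(uY)` produces the factor `u²`, with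
quotient `w = X_u Y_y - Y_u X_y + X Q - Y P`. On `u = 0` one finds `X = 1`, `P = 0`, `Q = -p'`, so
`w = -p'(y)` there. At a simple critical point `c`, `∂w/∂y = -p''(c) ≠ 0` while `dφ₊⁻¹ = du`, so
`(φ₊⁻¹, w)` are local coordinates and the inverse function theorem concludes. Off `u = 0`, the
continued functions are powers of `φ₊` and `φ₋^d`, which changes the wedge product only by
nonvanishing factors. -/

/-! ### Holomorphic functions of two variables: Cauchy integrals, division, series. -/

open Metric Set MeasureTheory in
/-- Holomorphic dependence on the parameter of an integral over translates along a path. -/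
theorem differentiableAt_intervalIntegral_translate {G : ℂ × ℂ → ℂ} {U : Set (ℂ × ℂ)}
    (hU : IsOpen U) (hG : DifferentiableOn ℂ G U) {k γ : ℝ → ℂ} (hk : Continuous k)
    (hγ : Continuous γ) (v : ℂ × ℂ) (a b : ℝ) (z₀ : ℂ × ℂ)
    (hz₀ : ∀ t ∈ uIcc a b, z₀ + γ t • v ∈ U) :
    DifferentiableAt ℂ (fun z => ∫ t in a..b, k t * G (z + γ t • v)) z₀ := by
  have hpath : Continuous fun t => z₀ + γ t • v := by fun_prop
  have hK : IsCompact ((fun t => z₀ + γ t • v) '' uIcc a b) := isCompact_uIcc.image hpath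
  -- Half of `δ` is spent on moving `z`, the other half on the Cauchy estimate for the derivative.
  obtain ⟨δ, hδ, hδU⟩ := hK.exists_cthickening_subset_open hU (by
    rintro _ ⟨t, ht, rfl⟩; exact hz₀ t ht)
  obtain ⟨M, hM⟩ := hK.cthickening.exists_bound_of_continuousOn (hG.continuousOn.mono hδU)
  have hmem : ∀ t ∈ uIcc a b, ∀ w, dist w (z₀ + γ t • v) ≤ δ →
      w ∈ U ∧ ‖G w‖ ≤ M := fun t ht w hw => by
    have : w ∈ cthickening δ ((fun t => z₀ + γ t • v) '' uIcc a b) :=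
      mem_cthickening_of_dist_le _ _ _ _ ⟨t, ht, rfl⟩ hw
    exact ⟨hδU this, hM _ this⟩
  have hdist : ∀ t, ∀ z ∈ ball z₀ (δ / 2), dist (z + γ t • v) (z₀ + γ t • v) < δ / 2 := by
    intro t z hz; simpa using hz
  have hcont : ∀ z ∈ ball z₀ (δ / 2), ContinuousOn (fun t => k t * G (z + γ t • v)) (uIcc a b) := by
    intro z hz
    refine hk.continuousOn.mul (hG.continuousOn.comp (by fun_prop) fun t ht => ?_)
    exact (hmem t ht _ ((hdist t z hz).le.trans (by linarith))).1
  have hdiff : ∀ t ∈ uIcc a b, ∀ z ∈ ball z₀ (δ / 2),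
      HasFDerivAt (fun z => k t * G (z + γ t • v)) (k t • fderiv ℂ G (z + γ t • v)) z := by
    intro t ht z hz
    have h1 := (hG.differentiableAt (hU.mem_nhds
      (hmem t ht _ ((hdist t z hz).le.trans (by linarith))).1)).hasFDerivAt
    have h2 : HasFDerivAt (fun z : ℂ × ℂ => z + γ t • v) (ContinuousLinearMap.id ℂ (ℂ × ℂ)) z :=
      (hasFDerivAt_id z).add_const _
    simpa using (h1.comp z h2).const_mul (k t)
  have hbound : ∀ t ∈ uIcc a b, ∀ z ∈ ball z₀ (δ / 2),
      ‖k t • fderiv ℂ G (z + γ t • v)‖ ≤ ‖k t‖ * (2 * M / (δ / 2)) := by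
    intro t ht z hz
    rw [norm_smul]
    gcongr
    have hin : ∀ w ∈ ball (z + γ t • v) (δ / 2), w ∈ U ∧ ‖G w‖ ≤ M := fun w hw =>
      hmem t ht w (by
        have := dist_triangle w (z + γ t • v) (z₀ + γ t • v)
        have := hdist t z hz
        have := mem_ball.1 hw
        linarith)
    refine Complex.norm_fderiv_le_div_of_mapsTo_ball (hG.mono fun w hw => (hin w hw).1)
      (fun w hw => ?_) (by positivity)
    rw [mem_closedBall, dist_eq_norm]
    have h1 := (hin w hw).2
    have h2 := (hin _ (mem_ball_self (by positivity))).2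
    linarith [norm_sub_le (G w) (G (z + γ t • v))]
  refine (intervalIntegral.hasFDerivAt_integral_of_dominated_of_fderiv_le
    (F' := fun z t => k t • fderiv ℂ G (z + γ t • v))
    (bound := fun t => ‖k t‖ * (2 * M / (δ / 2)))
    (ball_mem_nhds z₀ (half_pos hδ)) ?_ ?_ ?_ ?_ ?_ ?_).differentiableAt
  · filter_upwards [ball_mem_nhds z₀ (half_pos hδ)] with z hz
    exact ((hcont z hz).mono uIoc_subset_uIcc).aestronglyMeasurable measurableSet_uIoc
  · exact (hcont z₀ (mem_ball_self (half_pos hδ))).intervalIntegrable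
  · refine AEStronglyMeasurable.smul hk.aestronglyMeasurable ?_
    have : SecondCountableTopology ((ℂ × ℂ) →L[ℂ] ℂ) := by
      have : ProperSpace ((ℂ × ℂ) →L[ℂ] ℂ) := FiniteDimensional.proper ℂ _
      exact secondCountable_of_proper
    exact ((measurable_fderiv ℂ G).comp hpath.measurable).aestronglyMeasurable
  · exact Filter.Eventually.of_forall fun t ht => hbound t (uIoc_subset_uIcc ht)
  · exact Continuous.intervalIntegrable (by fun_prop) _ _
  · exact Filter.Eventually.of_forall fun t ht => hdiff t (uIoc_subset_uIcc ht)

-- Cauchy integrals along complex lines in direction `v`: `n = 2` gives directional derivatives, and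
-- `n = 1` recovers values from a circle avoiding a bad point.
open Metric Set in
theorem differentiableAt_circleIntegral_translate {G : ℂ × ℂ → ℂ} {U : Set (ℂ × ℂ)}
    (hU : IsOpen U) (hG : DifferentiableOn ℂ G U) (n : ℕ) (v : ℂ × ℂ) {ρ : ℝ} (hρ : 0 < ρ)
    (z₀ : ℂ × ℂ) (hz₀ : ∀ ζ ∈ sphere (0 : ℂ) ρ, z₀ + ζ • v ∈ U) :
    DifferentiableAt ℂ (fun z => ∮ ζ in C(0, ρ), (ζ ^ n)⁻¹ • G (z + ζ • v)) z₀ := by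
  have hne : ∀ t, circleMap 0 ρ t ≠ 0 := fun t => circleMap_ne_center hρ.ne'
  have := differentiableAt_intervalIntegral_translate hU hG
    (k := fun t => deriv (circleMap 0 ρ) t * (circleMap 0 ρ t ^ n)⁻¹) (γ := circleMap 0 ρ)
    (by
      simp only [deriv_circleMap]
      exact ((continuous_circleMap 0 ρ).mul continuous_const).mul
        (((continuous_circleMap 0 ρ).pow n).inv₀ fun t => pow_ne_zero _ (hne t)))
    (continuous_circleMap 0 ρ) v 0 (2 * Real.pi) z₀
    (fun t _ => hz₀ _ (circleMap_mem_sphere 0 hρ.le t))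
  simpa only [circleIntegral, smul_eq_mul, mul_assoc] using this

open Metric Set Topology in
/-- Directional derivatives of a holomorphic function of two variables are holomorphic. -/
theorem differentiableOn_fderiv_apply {G : ℂ × ℂ → ℂ} {U : Set (ℂ × ℂ)}
    (hU : IsOpen U) (hG : DifferentiableOn ℂ G U) (v : ℂ × ℂ) :
    DifferentiableOn ℂ (fun z => fderiv ℂ G z v) U := by
  intro z₀ hz₀
  refine DifferentiableAt.differentiableWithinAt ?_
  obtain ⟨ε, hε, hεU⟩ := Metric.isOpen_iff.1 hU z₀ hz₀
  obtain ⟨ρ, hρ, hρv⟩ : ∃ ρ : ℝ, 0 < ρ ∧ ρ * ‖v‖ < ε / 2 :=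
    ⟨ε / 2 / (‖v‖ + 1), by positivity, by
      rw [div_mul_eq_mul_div, div_lt_iff₀ (by positivity)]
      nlinarith⟩
  have hin : ∀ z ∈ ball z₀ (ε / 2), ∀ ζ ∈ closedBall (0 : ℂ) ρ, z + ζ • v ∈ U := by
    intro z hz ζ hζ
    apply hεU
    rw [mem_ball, dist_eq_norm] at *
    rw [mem_closedBall_zero_iff] at hζ
    have h1 : ‖ζ • v‖ ≤ ρ * ‖v‖ := by rw [norm_smul]; gcongr
    have h2 : z + ζ • v - z₀ = (z - z₀) + ζ • v := by abel
    rw [h2]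
    linarith [norm_add_le (z - z₀) (ζ • v)]
  have h0 := (differentiableAt_circleIntegral_translate hU hG 2 v hρ z₀ fun ζ hζ =>
    hin z₀ (mem_ball_self (half_pos hε)) ζ (sphere_subset_closedBall hζ)).const_smul
      (2 * Real.pi * Complex.I : ℂ)⁻¹
  refine h0.congr_of_eventuallyEq ?_
  filter_upwards [ball_mem_nhds z₀ (half_pos hε)] with z hz
  have hmaps : ∀ ζ : ℂ, HasDerivAt (fun ζ : ℂ => z + ζ • v) v ζ := fun ζ => by
    simpa using ((hasDerivAt_id ζ).smul_const v).const_add z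
  have hV : IsOpen ((fun ζ : ℂ => z + ζ • v) ⁻¹' U) := hU.preimage (by fun_prop)
  have hd : DifferentiableOn ℂ (fun ζ : ℂ => G (z + ζ • v)) ((fun ζ : ℂ => z + ζ • v) ⁻¹' U) :=
    fun ζ hζ => ((hG.differentiableAt (hU.mem_nhds hζ)).comp ζ
      (hmaps ζ).differentiableAt).differentiableWithinAt
  have h1 := Complex.two_pi_I_inv_smul_circleIntegral_sub_sq_inv_smul_of_differentiable hV
    (fun ζ hζ => hin z hz ζ hζ) hd (mem_ball_self hρ)
  have h2 : HasDerivAt (fun ζ : ℂ => G (z + ζ • v)) (fderiv ℂ G z v) 0 := by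
    have hz' : z ∈ U := by simpa using hin z hz 0 (mem_closedBall_self hρ.le)
    refine HasFDerivAt.comp_hasDerivAt (0 : ℂ) ?_ (hmaps 0)
    simpa using (hG.differentiableAt (hU.mem_nhds hz')).hasFDerivAt
  rw [h2.deriv] at h1
  simpa using h1.symm

open Metric Set Topology in
/-- A holomorphic function of two variables that vanishes on `{z.1 = 0}` is divisible by `z.1`. -/
theorem exists_eq_fst_mul_of_differentiableOn {G : ℂ × ℂ → ℂ} {U : Set (ℂ × ℂ)}
    (hU : IsOpen U) (hG : DifferentiableOn ℂ G U) (h0 : ∀ z ∈ U, z.1 = 0 → G z = 0) :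
    ∃ H : ℂ × ℂ → ℂ, DifferentiableOn ℂ H U ∧ ∀ z ∈ U, G z = z.1 * H z := by
  classical
  set H : ℂ × ℂ → ℂ := fun z => if z.1 = 0 then fderiv ℂ G z (1, 0) else G z / z.1 with hH
  have hV : IsOpen (U ∩ {z : ℂ × ℂ | z.1 ≠ 0}) :=
    hU.inter (isOpen_ne.preimage continuous_fst)
  have hHV : DifferentiableOn ℂ H (U ∩ {z : ℂ × ℂ | z.1 ≠ 0}) := by
    have h1 : DifferentiableOn ℂ (fun z => G z / z.1) (U ∩ {z : ℂ × ℂ | z.1 ≠ 0}) := by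
      simp only [div_eq_mul_inv]
      exact (hG.mono inter_subset_left).mul
        (differentiable_fst.differentiableOn.inv fun z hz => hz.2)
    exact h1.congr fun z hz => if_neg hz.2
  refine ⟨H, fun z₀ hz₀ => DifferentiableAt.differentiableWithinAt ?_, fun z hz => ?_⟩
  · by_cases hz1 : z₀.1 = 0
    · obtain ⟨ε, hε, hεU⟩ := Metric.isOpen_iff.1 hU z₀ hz₀
      obtain ⟨ρ, hρ, hρε⟩ : ∃ ρ : ℝ, 0 < ρ ∧ 2 * ρ = ε := ⟨ε / 2, by positivity, by ring⟩
      have hin : ∀ u y : ℂ, ‖u‖ < ε → dist y z₀.2 < ε → (u, y) ∈ U := fun u y hu hy =>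
        hεU (by
          rw [mem_ball, Prod.dist_eq]
          exact max_lt (by simpa [hz1] using hu) hy)
      -- Near `u = 0`, `H` is its own Cauchy integral over a circle in the first variable. For the
      -- base point `z₀` this circle misses `u = 0`, so only the known holomorphy of `H` off that
      -- line is used.
      have h1 := (differentiableAt_circleIntegral_translate hV hHV 1 (1, 0) hρ z₀ fun ζ hζ => by
        have hζ' : ‖ζ‖ = ρ := by simpa using hζ
        refine ⟨?_, ?_⟩
        · have := hin ζ z₀.2 (by linarith) (by simpa using hε)
          simpa [hz1, Prod.add_def] using this
        · have : ζ ≠ 0 := norm_pos_iff.1 (hζ' ▸ hρ)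
          simpa [hz1] using this).const_smul (2 * Real.pi * Complex.I : ℂ)⁻¹
      refine h1.congr_of_eventuallyEq ?_
      filter_upwards [ball_mem_nhds z₀ hρ] with z hz
      rw [mem_ball, Prod.dist_eq, max_lt_iff] at hz
      have hzu : ‖z.1‖ < ρ := by simpa [hz1] using hz.1
      have hzy : dist z.2 z₀.2 < ε := by linarith [hz.2]
      have hslice : DifferentiableOn ℂ (fun u => G (u, z.2)) (ball 0 ε) := fun u hu =>
        ((hG.differentiableAt (hU.mem_nhds (hin u z.2 (by simpa using hu) hzy))).comp u
          (by fun_prop)).differentiableWithinAt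
      have hdsl := (Complex.differentiableOn_dslope (ball_mem_nhds (0 : ℂ) hε)).2 hslice
      have hzero : G (0, z.2) = 0 := h0 _ (hin 0 z.2 (by simpa using hε) hzy) rfl
      -- On each horizontal slice the singularity is removable by the one-variable theory, which
      -- justifies Cauchy's formula.
      have hHd : ∀ u ∈ ball (0 : ℂ) ε, H (u, z.2) = dslope (fun u => G (u, z.2)) 0 u := by
        intro u hu
        by_cases hu0 : u = 0
        · subst hu0
          have hd := hG.differentiableAt (hU.mem_nhds (hin 0 z.2 (by simpa using hε) hzy))
          have h2 : HasDerivAt (fun u => G (u, z.2)) (fderiv ℂ G (0, z.2) (1, 0)) 0 :=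
            HasFDerivAt.comp_hasDerivAt (0 : ℂ) hd.hasFDerivAt
              ((hasDerivAt_id (0 : ℂ)).prodMk (hasDerivAt_const (0 : ℂ) z.2))
          rw [dslope_same, h2.deriv]
          simp [hH]
        · rw [dslope_of_ne _ hu0, slope_def_field, hzero]
          simp [hH, hu0]
      have hmaps : ∀ ζ ∈ closedBall (0 : ℂ) ρ, z.1 + ζ ∈ ball (0 : ℂ) ε := by
        intro ζ hζ
        rw [mem_closedBall_zero_iff] at hζ
        rw [mem_ball_zero_iff]
        linarith [norm_add_le z.1 ζ]
      have hd : DifferentiableOn ℂ (fun ζ : ℂ => H (z + ζ • ((1, 0) : ℂ × ℂ))) (closedBall 0 ρ) := by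
        refine DifferentiableOn.congr (hdsl.comp (f := fun ζ : ℂ => z.1 + ζ) (by fun_prop) hmaps) ?_
        intro ζ hζ
        simpa [Prod.add_def] using hHd _ (hmaps ζ hζ)
      have h3 := (hd.diffContOnCl_ball subset_rfl).two_pi_i_inv_smul_circleIntegral_sub_inv_smul
        (mem_ball_self hρ)
      simpa using h3.symm
    · exact hHV.differentiableAt (hV.mem_nhds ⟨hz₀, hz1⟩)
  · by_cases hz1 : z.1 = 0
    · rw [h0 z hz hz1, hz1, zero_mul]
    · simp only [hH, if_neg hz1]
      field_simp

open Metric Set in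
/-- The sum of a normally convergent series of holomorphic functions is holomorphic. -/
theorem differentiableOn_tsum_of_norm_le {E : Type*} [NormedAddCommGroup E] [NormedSpace ℂ E]
    {F : ℕ → E → ℂ} {U : Set E} {u : ℕ → ℝ} (hu : Summable u) (hU : IsOpen U)
    (hF : ∀ n, DifferentiableOn ℂ (F n) U) (hle : ∀ n, ∀ z ∈ U, ‖F n z‖ ≤ u n) :
    DifferentiableOn ℂ (fun z => ∑' n, F n z) U := by
  intro z₀ hz₀
  obtain ⟨ε, hε, hεU⟩ := Metric.isOpen_iff.1 hU z₀ hz₀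
  have hin : ∀ z ∈ ball z₀ (ε / 2), ball z (ε / 2) ⊆ U := fun z hz => by
    refine (ball_subset_ball' ?_).trans hεU
    linarith [mem_ball.1 hz]
  have hbound : ∀ n, ∀ z ∈ ball z₀ (ε / 2), ‖fderiv ℂ (F n) z‖ ≤ 2 * u n / (ε / 2) := by
    intro n z hz
    refine Complex.norm_fderiv_le_div_of_mapsTo_ball ((hF n).mono (hin z hz)) (fun w hw => ?_)
      (half_pos hε)
    rw [mem_closedBall, dist_eq_norm]
    have h1 := hle n w (hin z hz hw)
    have h2 := hle n z (hin z hz (mem_ball_self (half_pos hε)))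
    linarith [norm_sub_le (F n w) (F n z)]
  have hmem := mem_ball_self (x := z₀) (half_pos hε)
  exact (hasFDerivAt_tsum_of_isPreconnected ((hu.mul_left 2).div_const (ε / 2)) isOpen_ball
    (convex_ball z₀ (ε / 2)).isPreconnected
    (fun n z hz => ((hF n).differentiableAt (hU.mem_nhds
      (hin z hz (mem_ball_self (half_pos hε))))).hasFDerivAt)
    hbound hmem (Summable.of_norm_bounded hu fun n => hle n z₀ hz₀)
    hmem).differentiableAt.differentiableWithinAt

/-! ### The Hénon family at infinity and its Böttcher logarithm. -/

noncomputable section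

/-- The factor `p(x) / x ^ d - c s / x ^ (d - 1)` in the coordinates `(u, s)`, `u = 1 / x`. -/
def henonFactor (p : ℂ[X]) (c : ℂ) (w : ℂ × ℂ) : ℂ :=
  p.reverse.eval w.1 - c * w.2 * w.1 ^ (p.natDegree - 1)

/-- The map `(x, y) ↦ ((p(x) - c y) / b, x)` in the coordinates `u = 1 / x`, `s = y / x`; it is
holomorphic at `u = 0`, and also makes sense for `b = 0`. -/
def henonAtInfinity (p : ℂ[X]) (b c : ℂ) (w : ℂ × ℂ) : ℂ × ℂ :=
  (b * w.1 ^ p.natDegree / henonFactor p c w, b * w.1 ^ (p.natDegree - 1) / henonFactor p c w)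

/-- The logarithm of the Böttcher coordinate of `henonAtInfinity p b c` divided by `x`. -/
def bottcherLog (p : ℂ[X]) (b c : ℂ) (w : ℂ × ℂ) : ℂ :=
  ∑' k : ℕ, (1 / (p.natDegree : ℂ) ^ (k + 1)) *
    Complex.log (henonFactor p c ((henonAtInfinity p b c)^[k] w))

/-- The domain `V₊` together with its points at infinity, in the coordinates `(u, s)`. -/
def bottcherDomain (α : ℝ) : Set (ℂ × ℂ) := {w | α * ‖w.1‖ < 1 ∧ ‖w.2‖ < 1}

end

theorem isOpen_bottcherDomain (α : ℝ) : IsOpen (bottcherDomain α) :=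
  IsOpen.inter (s := {w : ℂ × ℂ | α * ‖w.1‖ < 1}) (t := {w : ℂ × ℂ | ‖w.2‖ < 1})
    (isOpen_lt (by fun_prop) continuous_const) (isOpen_lt (by fun_prop) continuous_const)

theorem eval_reverse_inv (p : ℂ[X]) {x : ℂ} (hx : x ≠ 0) :
    p.reverse.eval x⁻¹ = p.eval x / x ^ p.natDegree := by
  let := invertibleOfNonzero hx
  rw [eq_div_iff (pow_ne_zero _ hx)]
  simpa [eval₂_eq_eval_map] using eval₂_reverse_mul_pow (RingHom.id ℂ) x p

theorem henonFactor_inv (p : ℂ[X]) (hd : 2 ≤ p.natDegree) (c : ℂ) {x : ℂ} (hx : x ≠ 0) (s : ℂ) :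
    henonFactor p c (x⁻¹, s) = (p.eval x - c * s * x) / x ^ p.natDegree := by
  obtain ⟨m, hm⟩ : ∃ m, p.natDegree = m + 1 := ⟨p.natDegree - 1, by omega⟩
  simp only [henonFactor, eval_reverse_inv p hx, hm, Nat.add_sub_cancel, inv_pow]
  field_simp
  ring

theorem henonFactor_zero {p : ℂ[X]} (hp : p.Monic) (hd : 2 ≤ p.natDegree) (c s : ℂ) :
    henonFactor p c (0, s) = 1 := by
  have : p.natDegree - 1 ≠ 0 := by omega
  simp [henonFactor, this, ← coeff_zero_eq_eval_zero, coeff_zero_reverse, hp.leadingCoeff]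

theorem henonAtInfinity_zero {p : ℂ[X]} (hd : 2 ≤ p.natDegree) (b c s : ℂ) :
    henonAtInfinity p b c (0, s) = 0 := by
  have h1 : p.natDegree - 1 ≠ 0 := by omega
  have h2 : p.natDegree ≠ 0 := by omega
  simp [henonAtInfinity, h1, h2]

/-- The orbit stays on `u = 0`, where every factor is `1` because `p` is monic. -/
theorem bottcherLog_zero {p : ℂ[X]} (hp : p.Monic) (hd : 2 ≤ p.natDegree) (b c s : ℂ) :
    bottcherLog p b c (0, s) = 0 := by
  have h : ∀ k, ∃ t, (henonAtInfinity p b c)^[k] (0, s) = (0, t) := by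
    intro k
    induction k with
    | zero => exact ⟨s, rfl⟩
    | succ k ih =>
      obtain ⟨t, ht⟩ := ih
      exact ⟨0, by rw [Function.iterate_succ_apply', ht, henonAtInfinity_zero hd]; rfl⟩
  rw [bottcherLog]
  convert tsum_zero with k
  obtain ⟨t, ht⟩ := h k
  rw [ht, henonFactor_zero hp hd, Complex.log_one, mul_zero]

theorem henonAtInfinity_inv (p : ℂ[X]) (hd : 2 ≤ p.natDegree) (b c : ℂ) {x : ℂ} (hx : x ≠ 0)
    (s : ℂ) : henonAtInfinity p b c (x⁻¹, s) =
      (b / (p.eval x - c * s * x), b * x / (p.eval x - c * s * x)) := by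
  obtain ⟨m, hm⟩ : ∃ m, p.natDegree = m + 1 := ⟨p.natDegree - 1, by omega⟩
  simp only [henonAtInfinity, henonFactor_inv p hd c hx, hm, Nat.add_sub_cancel, inv_pow,
    div_div_eq_mul_div]
  congr 2
  · field_simp
  · field_simp
    ring

theorem natDegree_ne_zero_complex {p : ℂ[X]} (hd : 2 ≤ p.natDegree) : (p.natDegree : ℂ) ≠ 0 :=
  Nat.cast_ne_zero.2 (by omega)

/-! ### Invariance of the bidisc, convergence and functional equation. -/

section Domain

variable {p : ℂ[X]} {r R α : ℝ}

/-- The difference is `q(x) / x ^ d - c s / x ^ (d - 1)`, which the tail condition controls. This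
keeps the factors in a disc on which the principal logarithm is holomorphic. -/
theorem norm_henonFactor_sub_one_lt (hp : p.Monic) (hd : 2 ≤ p.natDegree)
    (hadm : HenonAdmissible p r R α) {c : ℂ} (hc : ‖c‖ ≤ R + 1) {w : ℂ × ℂ}
    (hw : w ∈ bottcherDomain α) : ‖henonFactor p c w - 1‖ < r := by
  obtain ⟨u, s⟩ := w
  obtain ⟨hu, hs⟩ := hw
  simp only at hu hs
  by_cases hu0 : u = 0
  · subst hu0
    simpa [henonFactor_zero hp hd] using hadm.r_pos
  obtain ⟨x, rfl⟩ : ∃ x, u = x⁻¹ := ⟨u⁻¹, by simp⟩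
  have hx : x ≠ 0 := by simpa using hu0
  have hxn : 0 < ‖x‖ := norm_pos_iff.2 hx
  have hαx : α ≤ ‖x‖ := by
    rw [norm_inv, ← div_eq_mul_inv, div_lt_one hxn] at hu
    exact hu.le
  obtain ⟨m, hm⟩ : ∃ m, p.natDegree = m + 1 := ⟨p.natDegree - 1, by omega⟩
  have key : henonFactor p c (x⁻¹, s) - 1 =
      (p - X ^ p.natDegree).eval x / x ^ p.natDegree - c * s / x ^ (p.natDegree - 1) := by
    rw [henonFactor_inv p hd c hx]
    simp only [eval_sub, eval_pow, eval_X, hm, Nat.add_sub_cancel]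
    field_simp
    ring
  rw [key]
  refine lt_of_le_of_lt (norm_sub_le _ _) (lt_of_le_of_lt ?_ (hadm.tail_lt x hαx))
  gcongr
  rw [norm_div, norm_mul, norm_pow]
  gcongr
  calc ‖c‖ * ‖s‖ ≤ (R + 1) * 1 := by gcongr; linarith [hadm.R_pos]
    _ = R + 1 := mul_one _

theorem henonFactor_mem_slitPlane (hp : p.Monic) (hd : 2 ≤ p.natDegree)
    (hadm : HenonAdmissible p r R α) {c : ℂ} (hc : ‖c‖ ≤ R + 1) {w : ℂ × ℂ}
    (hw : w ∈ bottcherDomain α) : henonFactor p c w ∈ Complex.slitPlane := by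
  have := Complex.mem_slitPlane_of_norm_lt_one
    ((norm_henonFactor_sub_one_lt hp hd hadm hc hw).trans hadm.r_lt_one)
  simpa using this

theorem henonFactor_ne_zero (hp : p.Monic) (hd : 2 ≤ p.natDegree)
    (hadm : HenonAdmissible p r R α) {c : ℂ} (hc : ‖c‖ ≤ R + 1) {w : ℂ × ℂ}
    (hw : w ∈ bottcherDomain α) : henonFactor p c w ≠ 0 :=
  Complex.slitPlane_ne_zero (henonFactor_mem_slitPlane hp hd hadm hc hw)

/-- Growth gives `|p(x) - c s x| > (2 R + 1 - |c|) |x| ≥ |b| |x|`, so the new `s` has modulus below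
`1`. The new `u` is the old `u` times the new `s`, so its bound is inherited. -/
theorem mapsTo_henonAtInfinity (hd : 2 ≤ p.natDegree)
    (hadm : HenonAdmissible p r R α) {b c : ℂ} (hbc : ‖b‖ + ‖c‖ ≤ R + 1) :
    Set.MapsTo (henonAtInfinity p b c) (bottcherDomain α) (bottcherDomain α) := by
  rintro ⟨u, s⟩ ⟨hu, hs⟩
  simp only at hu hs
  by_cases hu0 : u = 0
  · subst hu0
    rw [henonAtInfinity_zero hd]
    simp [bottcherDomain]
  obtain ⟨x, rfl⟩ : ∃ x, u = x⁻¹ := ⟨u⁻¹, by simp⟩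
  have hx : x ≠ 0 := by simpa using hu0
  have hxn : 0 < ‖x‖ := norm_pos_iff.2 hx
  have hαx : α ≤ ‖x‖ := by
    rw [norm_inv, ← div_eq_mul_inv, div_lt_one hxn] at hu
    exact hu.le
  have hlt : ‖b‖ * ‖x‖ < ‖p.eval x - c * s * x‖ := by
    have h1 := hadm.growth x hαx
    have h2 : ‖p.eval x‖ ≤ ‖p.eval x - c * s * x‖ + ‖c‖ * ‖x‖ := by
      calc ‖p.eval x‖ = ‖(p.eval x - c * s * x) + c * s * x‖ := by ring_nf
        _ ≤ ‖p.eval x - c * s * x‖ + ‖c * s * x‖ := norm_add_le _ _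
        _ ≤ _ := by
          rw [norm_mul, norm_mul]
          gcongr
          exact mul_le_of_le_one_right (norm_nonneg _) hs.le
    nlinarith [hadm.R_pos]
  have hne : p.eval x - c * s * x ≠ 0 := norm_pos_iff.1 (lt_of_le_of_lt (by positivity) hlt)
  have h3 : ‖b * x / (p.eval x - c * s * x)‖ < 1 := by
    rw [norm_div, norm_mul, div_lt_one (norm_pos_iff.2 hne)]
    exact hlt
  rw [henonAtInfinity_inv p hd b c hx]
  refine ⟨?_, h3⟩
  have h1 : b / (p.eval x - c * s * x) = x⁻¹ * (b * x / (p.eval x - c * s * x)) := by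
    field_simp
  simp only [h1, norm_mul, ← mul_assoc]
  exact mul_lt_one_of_nonneg_of_lt_one_left (mul_nonneg hadm.alpha_pos.le (norm_nonneg _)) hu h3.le

theorem differentiable_henonFactor (p : ℂ[X]) (c : ℂ) : Differentiable ℂ (henonFactor p c) := by
  have : Differentiable ℂ fun w : ℂ × ℂ => p.reverse.eval w.1 :=
    p.reverse.differentiable.comp differentiable_fst
  unfold henonFactor
  fun_prop

theorem differentiableOn_henonAtInfinity (hp : p.Monic) (hd : 2 ≤ p.natDegree)
    (hadm : HenonAdmissible p r R α) (b : ℂ) {c : ℂ} (hc : ‖c‖ ≤ R + 1) :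
    DifferentiableOn ℂ (henonAtInfinity p b c) (bottcherDomain α) := by
  have h1 : DifferentiableOn ℂ (fun w => (henonFactor p c w)⁻¹) (bottcherDomain α) :=
    (differentiable_henonFactor p c).differentiableOn.inv fun w hw =>
      henonFactor_ne_zero hp hd hadm hc hw
  unfold henonAtInfinity
  simp only [div_eq_mul_inv]
  fun_prop

/-- All logarithms are taken on the compact disc of radius `r < 1` about `1`, hence are uniformly
bounded; the weights are at most `2 ^ (-(k + 1))`. -/
theorem exists_summable_norm_bottcherLog_le (hp : p.Monic) (hd : 2 ≤ p.natDegree)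
    (hadm : HenonAdmissible p r R α) {b c : ℂ} (hbc : ‖b‖ + ‖c‖ ≤ R + 1) :
    ∃ u : ℕ → ℝ, Summable u ∧ ∀ k, ∀ w ∈ bottcherDomain α, ‖(1 / (p.natDegree : ℂ) ^ (k + 1)) *
      Complex.log (henonFactor p c ((henonAtInfinity p b c)^[k] w))‖ ≤ u k := by
  have hc : ‖c‖ ≤ R + 1 := by linarith [norm_nonneg b]
  have hmaps := mapsTo_henonAtInfinity hd hadm hbc
  have hK : Metric.closedBall (1 : ℂ) r ⊆ Complex.slitPlane := fun z hz => by
    rw [mem_closedBall_iff_norm] at hz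
    simpa using Complex.mem_slitPlane_of_norm_lt_one (hz.trans_lt hadm.r_lt_one)
  obtain ⟨M, hM⟩ := (isCompact_closedBall (1 : ℂ) r).exists_bound_of_continuousOn
    (f := Complex.log) fun z hz => continuousWithinAt_id.clog (hK hz)
  have hd2 : (2 : ℝ) ≤ p.natDegree := by exact_mod_cast hd
  refine ⟨fun k : ℕ => (1 / (2 : ℝ)) ^ (k + 1) * M,
    ((summable_nat_add_iff 1).2 summable_geometric_two).mul_right M, fun k w hw => ?_⟩
  rw [norm_mul]
  have h1 : ‖(1 / (p.natDegree : ℂ) ^ (k + 1))‖ ≤ (1 / (2 : ℝ)) ^ (k + 1) := by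
    rw [norm_div, norm_one, norm_pow, Complex.norm_natCast, div_pow, one_pow]
    gcongr
  refine mul_le_mul h1 (hM _ ?_) (norm_nonneg _) (by positivity)
  rw [mem_closedBall_iff_norm]
  exact (norm_henonFactor_sub_one_lt hp hd hadm hc (hmaps.iterate k hw)).le

theorem differentiableOn_bottcherLog (hp : p.Monic) (hd : 2 ≤ p.natDegree)
    (hadm : HenonAdmissible p r R α) {b c : ℂ} (hbc : ‖b‖ + ‖c‖ ≤ R + 1) :
    DifferentiableOn ℂ (bottcherLog p b c) (bottcherDomain α) := by
  have hc : ‖c‖ ≤ R + 1 := by linarith [norm_nonneg b]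
  have hmaps := mapsTo_henonAtInfinity hd hadm hbc
  obtain ⟨u, hu, hle⟩ := exists_summable_norm_bottcherLog_le hp hd hadm hbc
  refine differentiableOn_tsum_of_norm_le hu (isOpen_bottcherDomain α) (fun k => ?_) hle
  have hit : DifferentiableOn ℂ ((henonAtInfinity p b c)^[k]) (bottcherDomain α) :=
    (differentiableOn_henonAtInfinity hp hd hadm b hc).iterate hmaps k
  refine ((differentiable_henonFactor p c).comp_differentiableOn hit).clog (fun w hw => ?_)
    |>.const_mul _
  exact henonFactor_mem_slitPlane hp hd hadm hc (hmaps.iterate k hw)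

/-- Multiplication by `d` shifts the series by one index. Stated for logarithms, it involves no
choice of root. -/
theorem natDegree_mul_bottcherLog (hp : p.Monic) (hd : 2 ≤ p.natDegree)
    (hadm : HenonAdmissible p r R α) {b c : ℂ} (hbc : ‖b‖ + ‖c‖ ≤ R + 1) {w : ℂ × ℂ}
    (hw : w ∈ bottcherDomain α) :
    p.natDegree * bottcherLog p b c w =
      Complex.log (henonFactor p c w) + bottcherLog p b c (henonAtInfinity p b c w) := by
  obtain ⟨u, hu, hle⟩ := exists_summable_norm_bottcherLog_le hp hd hadm hbc
  have hd0 := natDegree_ne_zero_complex hd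
  have hs := Summable.of_norm_bounded hu fun k => hle k w hw
  rw [bottcherLog, hs.tsum_eq_zero_add, mul_add, ← tsum_mul_left, bottcherLog]
  congr 1
  · simp only [Function.iterate_zero, id]
    field_simp
    ring
  · refine tsum_congr fun k => ?_
    rw [Function.iterate_succ_apply]
    field_simp
    ring

theorem exp_bottcherLog_pow (hp : p.Monic) (hd : 2 ≤ p.natDegree)
    (hadm : HenonAdmissible p r R α) {b c : ℂ} (hbc : ‖b‖ + ‖c‖ ≤ R + 1) {w : ℂ × ℂ}
    (hw : w ∈ bottcherDomain α) :
    Complex.exp (bottcherLog p b c w) ^ p.natDegree =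
      henonFactor p c w * Complex.exp (bottcherLog p b c (henonAtInfinity p b c w)) := by
  have hc : ‖c‖ ≤ R + 1 := by linarith [norm_nonneg b]
  rw [← Complex.exp_nat_mul, natDegree_mul_bottcherLog hp hd hadm hbc hw, Complex.exp_add,
    Complex.exp_log (henonFactor_ne_zero hp hd hadm hc hw)]

end Domain

theorem mem_bottcherDomain_iff {α : ℝ} {x y : ℂ} (hx : x ≠ 0) :
    (x⁻¹, y / x) ∈ bottcherDomain α ↔ ‖y‖ < ‖x‖ ∧ α < ‖x‖ := by
  have hxn : 0 < ‖x‖ := norm_pos_iff.2 hx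
  simp only [bottcherDomain, Set.mem_ofPred_eq, norm_inv, norm_div, div_lt_one hxn,
    ← div_eq_mul_inv]
  exact and_comm

/-! ### The map `f_a` and `φ₊`, in the coordinates `(1 / x, y / x)`. -/

section Forward

variable {p : ℂ[X]} {r R α : ℝ} {a : ℂ} {z : ℂ × ℂ}

theorem HenonAdmissible.fst_ne_zero (hadm : HenonAdmissible p r R α) (hz : z ∈ henonVPlus α) :
    z.1 ≠ 0 :=
  norm_pos_iff.1 (hadm.alpha_pos.trans hz.2)

theorem HenonAdmissible.snd_ne_zero (hadm : HenonAdmissible p r R α) (hz : z ∈ henonVMinus α) :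
    z.2 ≠ 0 :=
  norm_pos_iff.1 (hadm.alpha_pos.trans hz.2)

theorem henonFactor_forward (hd : 2 ≤ p.natDegree) (a : ℂ) (hz : z.1 ≠ 0) :
    henonFactor p a (z.1⁻¹, z.2 / z.1) = (henon p a z).1 / z.1 ^ p.natDegree := by
  rw [henonFactor_inv p hd a hz, henon, mul_assoc, div_mul_cancel₀ _ hz]

theorem henonAtInfinity_forward (hd : 2 ≤ p.natDegree) (a : ℂ) (hz : z.1 ≠ 0) :
    henonAtInfinity p 1 a (z.1⁻¹, z.2 / z.1) =
      ((henon p a z).1⁻¹, (henon p a z).2 / (henon p a z).1) := by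
  rw [henonAtInfinity_inv p hd 1 a hz, henon, mul_assoc, div_mul_cancel₀ _ hz, one_div, one_mul]

theorem mapsTo_henon (hp : p.Monic) (hd : 2 ≤ p.natDegree) (hadm : HenonAdmissible p r R α)
    (ha : ‖a‖ ≤ R) : Set.MapsTo (henon p a) (henonVPlus α) (henonVPlus α) := by
  intro z hz
  have hz1 := hadm.fst_ne_zero hz
  have hw := (mem_bottcherDomain_iff hz1).2 hz
  have h1 := mapsTo_henonAtInfinity hd hadm (b := 1) (c := a) (by simp; linarith) hw
  rw [henonAtInfinity_forward hd a hz1] at h1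
  refine (mem_bottcherDomain_iff ?_).1 h1
  -- The first coordinate of the image must be shown nonzero separately: with `0⁻¹ = 0`, bidisc
  -- membership alone does not exclude it.
  have h2 := henonFactor_ne_zero hp hd hadm (c := a) (by linarith) hw
  rw [henonFactor_forward hd a hz1] at h2
  exact (div_ne_zero_iff.1 h2).1

theorem henonAtInfinity_iterate_forward (hp : p.Monic) (hd : 2 ≤ p.natDegree)
    (hadm : HenonAdmissible p r R α) (ha : ‖a‖ ≤ R) (hz : z ∈ henonVPlus α) (k : ℕ) :
    (henonAtInfinity p 1 a)^[k] (z.1⁻¹, z.2 / z.1) =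
      (((henon p a)^[k] z).1⁻¹, ((henon p a)^[k] z).2 / ((henon p a)^[k] z).1) := by
  induction k with
  | zero => rfl
  | succ k ih =>
    rw [Function.iterate_succ_apply', ih, Function.iterate_succ_apply', henonAtInfinity_forward hd]
    exact hadm.fst_ne_zero ((mapsTo_henon hp hd hadm ha).iterate k hz)

theorem phiPlus_eq (hp : p.Monic) (hd : 2 ≤ p.natDegree) (hadm : HenonAdmissible p r R α)
    (ha : ‖a‖ ≤ R) (hz : z ∈ henonVPlus α) :
    phiPlus p a z = z.1 * Complex.exp (bottcherLog p 1 a (z.1⁻¹, z.2 / z.1)) := by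
  rw [phiPlus, bottcherLog]
  congr 3
  ext k
  rw [henonAtInfinity_iterate_forward hp hd hadm ha hz, henonFactor_forward hd,
    Function.iterate_succ_apply']
  exact hadm.fst_ne_zero ((mapsTo_henon hp hd hadm ha).iterate k hz)

theorem phiPlus_henon (hp : p.Monic) (hd : 2 ≤ p.natDegree) (hadm : HenonAdmissible p r R α)
    (ha : ‖a‖ ≤ R) (hz : z ∈ henonVPlus α) :
    phiPlus p a (henon p a z) = phiPlus p a z ^ p.natDegree := by
  have hz1 := hadm.fst_ne_zero hz
  rw [phiPlus_eq hp hd hadm ha hz, phiPlus_eq hp hd hadm ha (mapsTo_henon hp hd hadm ha hz),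
    mul_pow, exp_bottcherLog_pow hp hd hadm (by simp; linarith)
      ((mem_bottcherDomain_iff hz1).2 hz), henonAtInfinity_forward hd a hz1,
    henonFactor_forward hd a hz1, ← mul_assoc, mul_div_cancel₀ _ (pow_ne_zero _ hz1)]

theorem phiPlus_henon_iterate (hp : p.Monic) (hd : 2 ≤ p.natDegree)
    (hadm : HenonAdmissible p r R α) (ha : ‖a‖ ≤ R) (hz : z ∈ henonVPlus α) (n : ℕ) :
    phiPlus p a ((henon p a)^[n] z) = phiPlus p a z ^ p.natDegree ^ n := by
  induction n with
  | zero => simp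
  | succ n ih =>
    rw [Function.iterate_succ_apply', phiPlus_henon hp hd hadm ha
      ((mapsTo_henon hp hd hadm ha).iterate n hz), ih, pow_succ, pow_mul]

end Forward

/-! ### The map `f_a⁻¹` and `φ₋`, in the swapped coordinates `(1 / y, x / y)`. -/

section Backward

variable {p : ℂ[X]} {r R α : ℝ} {a : ℂ} {z : ℂ × ℂ}

theorem henonFactor_backward (hd : 2 ≤ p.natDegree) (hz : z.2 ≠ 0) :
    henonFactor p 1 (z.2⁻¹, z.1 / z.2) = (p.eval z.2 - z.1) / z.2 ^ p.natDegree := by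
  rw [henonFactor_inv p hd 1 hz, one_mul, div_mul_cancel₀ _ hz]

theorem henonAtInfinity_backward (hd : 2 ≤ p.natDegree) (a : ℂ) (hz : z.2 ≠ 0) :
    henonAtInfinity p a 1 (z.2⁻¹, z.1 / z.2) =
      ((henonInv p a z).2⁻¹, (henonInv p a z).1 / (henonInv p a z).2) := by
  rw [henonAtInfinity_inv p hd a 1 hz, henonInv, one_mul, div_mul_cancel₀ _ hz]
  simp only [inv_div, div_div_eq_mul_div, mul_comm]

theorem mapsTo_henonInv (hp : p.Monic) (hd : 2 ≤ p.natDegree) (hadm : HenonAdmissible p r R α)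
    (ha : ‖a‖ ≤ R) (ha0 : a ≠ 0) :
    Set.MapsTo (henonInv p a) (henonVMinus α) (henonVMinus α) := by
  intro z hz
  have hz1 := hadm.snd_ne_zero hz
  have hw := (mem_bottcherDomain_iff hz1).2 hz
  have h1 := mapsTo_henonAtInfinity hd hadm (b := a) (c := 1) (by simp; linarith) hw
  rw [henonAtInfinity_backward hd a hz1] at h1
  refine (mem_bottcherDomain_iff ?_).1 h1
  have h2 := henonFactor_ne_zero hp hd hadm (c := 1) (by simpa using hadm.R_pos.le) hw
  rw [henonFactor_backward hd hz1] at h2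
  exact div_ne_zero (div_ne_zero_iff.1 h2).1 ha0

theorem henonAtInfinity_iterate_backward (hp : p.Monic) (hd : 2 ≤ p.natDegree)
    (hadm : HenonAdmissible p r R α) (ha : ‖a‖ ≤ R) (ha0 : a ≠ 0) (hz : z ∈ henonVMinus α)
    (k : ℕ) : (henonAtInfinity p a 1)^[k] (z.2⁻¹, z.1 / z.2) =
      (((henonInv p a)^[k] z).2⁻¹, ((henonInv p a)^[k] z).1 / ((henonInv p a)^[k] z).2) := by
  induction k with
  | zero => rfl
  | succ k ih =>
    rw [Function.iterate_succ_apply', ih, Function.iterate_succ_apply',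
      henonAtInfinity_backward hd]
    exact hadm.snd_ne_zero ((mapsTo_henonInv hp hd hadm ha ha0).iterate k hz)

theorem phiMinus_eq (hp : p.Monic) (hd : 2 ≤ p.natDegree) (hadm : HenonAdmissible p r R α)
    (ha : ‖a‖ ≤ R) (ha0 : a ≠ 0) (hz : z ∈ henonVMinus α) :
    phiMinus p a z = z.2 * Complex.exp (bottcherLog p a 1 (z.2⁻¹, z.1 / z.2)) := by
  rw [phiMinus, bottcherLog]
  congr 3
  ext k
  rw [henonAtInfinity_iterate_backward hp hd hadm ha ha0 hz, henonFactor_backward hd,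
    henonBackRatio, if_neg ha0, Function.iterate_succ_apply']
  · simp only [henonInv]
    rw [mul_div_cancel₀ _ ha0]
  · exact hadm.snd_ne_zero ((mapsTo_henonInv hp hd hadm ha ha0).iterate k hz)

theorem mul_phiMinus_henonInv (hp : p.Monic) (hd : 2 ≤ p.natDegree)
    (hadm : HenonAdmissible p r R α) (ha : ‖a‖ ≤ R) (ha0 : a ≠ 0) (hz : z ∈ henonVMinus α) :
    a * phiMinus p a (henonInv p a z) = phiMinus p a z ^ p.natDegree := by
  have hz1 := hadm.snd_ne_zero hz
  rw [phiMinus_eq hp hd hadm ha ha0 hz,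
    phiMinus_eq hp hd hadm ha ha0 (mapsTo_henonInv hp hd hadm ha ha0 hz),
    mul_pow, exp_bottcherLog_pow hp hd hadm (by simp; linarith)
      ((mem_bottcherDomain_iff hz1).2 hz), henonAtInfinity_backward hd a hz1,
    henonFactor_backward hd hz1, ← mul_assoc, ← mul_assoc, mul_div_cancel₀ _ (pow_ne_zero _ hz1)]
  simp only [henonInv, mul_div_cancel₀ _ ha0]

/-- For `a ≠ 0`, iterate `a φ₋ ∘ f_a⁻¹ = φ₋ ^ d`; the powers of `a` match through `1 + d + ⋯ + d ^
(k + 1) = d (1 + ⋯ + d ^ k) + 1`. -/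
theorem phiMinusPow_eq_pow (hp : p.Monic) (hd : 2 ≤ p.natDegree)
    (hadm : HenonAdmissible p r R α) (ha : ‖a‖ ≤ R) (hz : z ∈ phiMinusPowDomain p α a 0) (k : ℕ) :
    phiMinusPow p a k z = phiMinusPow p a 0 z ^ p.natDegree ^ k := by
  by_cases ha0 : a = 0
  · simp [phiMinusPow, ha0]
  have hz' : henonInv p a z ∈ henonVMinus α := by simpa [phiMinusPowDomain, ha0] using hz
  induction k with
  | zero => simp
  | succ k ih =>
    rw [pow_succ, pow_mul, ← ih]
    simp only [phiMinusPow, if_neg ha0]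
    rw [mul_pow, Function.iterate_succ_apply' _ (k + 1),
      ← mul_phiMinus_henonInv hp hd hadm ha ha0, geom_sum_succ, pow_succ, pow_mul', mul_assoc]
    rw [Function.iterate_succ_apply]
    exact (mapsTo_henonInv hp hd hadm ha ha0).iterate k hz'

/-- Since `a y₋₁ = p(y) - x`, the division by `a` disappears. At `a = 0` the logarithm is evaluated
at the origin, where it vanishes, so one formula serves all parameters. -/
theorem phiMinusPow_zero_eq (hp : p.Monic) (hd : 2 ≤ p.natDegree)
    (hadm : HenonAdmissible p r R α) (ha : ‖a‖ ≤ R) (hz : z ∈ phiMinusPowDomain p α a 0) :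
    phiMinusPow p a 0 z = (p.eval z.2 - z.1) *
      Complex.exp (bottcherLog p a 1 (a / (p.eval z.2 - z.1), a * z.2 / (p.eval z.2 - z.1))) := by
  by_cases ha0 : a = 0
  · simp [phiMinusPow, ha0, bottcherLog_zero hp hd]
  have hz' : henonInv p a z ∈ henonVMinus α := by simpa [phiMinusPowDomain, ha0] using hz
  simp only [phiMinusPow, if_neg ha0, zero_add, Finset.range_one, Finset.sum_singleton, pow_zero,
    pow_one, Function.iterate_one]
  rw [phiMinus_eq hp hd hadm ha ha0 hz', ← mul_assoc]
  simp only [henonInv, mul_div_cancel₀ _ ha0, inv_div, div_div_eq_mul_div, mul_comm]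

theorem mem_phiMinusPowDomain_iff (hadm : HenonAdmissible p r R α) :
    z ∈ phiMinusPowDomain p α a 0 ↔ p.eval z.2 - z.1 ≠ 0 ∧
      (a / (p.eval z.2 - z.1), a * z.2 / (p.eval z.2 - z.1)) ∈ bottcherDomain α := by
  by_cases ha0 : a = 0
  · simp [phiMinusPowDomain, ha0, sub_eq_zero, bottcherDomain]
  have hiff : z ∈ phiMinusPowDomain p α a 0 ↔ henonInv p a z ∈ henonVMinus α := by
    simp [phiMinusPowDomain, ha0]
  have hη : (a / (p.eval z.2 - z.1), a * z.2 / (p.eval z.2 - z.1)) =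
      ((henonInv p a z).2⁻¹, (henonInv p a z).1 / (henonInv p a z).2) := by
    simp only [henonInv, inv_div, div_div_eq_mul_div, mul_comm]
  rw [hiff, hη]
  constructor
  · intro hz
    have h0 := hadm.snd_ne_zero hz
    exact ⟨(div_ne_zero_iff.1 h0).1, (mem_bottcherDomain_iff h0).2 hz⟩
  · rintro ⟨h0, hz⟩
    exact (mem_bottcherDomain_iff (div_ne_zero h0 ha0)).1 hz

end Backward

/-! ### The functions `φ₊⁻¹` and `φ₋^{-d}` near `x = ∞`, in the coordinates `(u, y)`. -/

noncomputable section

/-- The function `x⁻¹ / (p(y) / x - 1) = 1 / (p(y) - x)` divided by `u = x⁻¹`. -/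
def henonPole (p : ℂ[X]) (z : ℂ × ℂ) : ℂ := (z.1 * p.eval z.2 - 1)⁻¹

end

section

variable {p : ℂ[X]} {r R α : ℝ} {a : ℂ} {z : ℂ × ℂ}

theorem differentiable_eval_snd (p : ℂ[X]) : Differentiable ℂ fun z : ℂ × ℂ => p.eval z.2 :=
  p.differentiable.comp differentiable_snd

theorem inv_eval_sub (p : ℂ[X]) (hz : z.1 ≠ 0) :
    (p.eval z.2 - z.1⁻¹)⁻¹ = z.1 * henonPole p z := by
  rw [henonPole]
  have : p.eval z.2 - z.1⁻¹ = (z.1 * p.eval z.2 - 1) / z.1 := by field_simp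
  rw [this, inv_div, div_eq_mul_inv]

/-- Removes the case distinctions in `u` and `a`, so that openness and holomorphy can be read off
from explicit maps into the bidisc. -/
theorem mem_critDomainAtInfinity_iff (hadm : HenonAdmissible p r R α) :
    z ∈ critDomainAtInfinity p α a ↔ (z.1, z.1 * z.2) ∈ bottcherDomain α ∧
      z.1 * p.eval z.2 - 1 ≠ 0 ∧
      (z.1 * (a * henonPole p z), z.1 * (a * z.2 * henonPole p z)) ∈ bottcherDomain α := by
  obtain ⟨u, y⟩ := z
  by_cases hu : u = 0
  · simp [critDomainAtInfinity, bottcherDomain, hu]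
  have h1 : (u⁻¹, y) ∈ henonVPlus α ↔ (u, u * y) ∈ bottcherDomain α := by
    have := mem_bottcherDomain_iff (α := α) (y := y) (inv_ne_zero hu)
    rw [inv_inv, div_inv_eq_mul, mul_comm y u] at this
    exact this.symm
  have h2 : p.eval y - u⁻¹ ≠ 0 ↔ u * p.eval y - 1 ≠ 0 := by
    have : u * p.eval y - 1 = u * (p.eval y - u⁻¹) := by field_simp
    rw [this]
    simp [hu]
  have h3 := inv_eval_sub (z := (u, y)) p hu
  simp only at h3
  simp only [critDomainAtInfinity, Set.mem_ofPred_eq, hu, false_or, h1,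
    mem_phiMinusPowDomain_iff hadm, h2, div_eq_mul_inv, h3, mul_left_comm]

theorem differentiableOn_henonPole (hadm : HenonAdmissible p r R α) :
    DifferentiableOn ℂ (henonPole p) (critDomainAtInfinity p α a) := by
  have := differentiable_eval_snd p
  refine DifferentiableOn.inv (by fun_prop) fun z hz => ?_
  exact ((mem_critDomainAtInfinity_iff hadm).1 hz).2.1

theorem isOpen_critDomainAtInfinity (hadm : HenonAdmissible p r R α) :
    IsOpen (critDomainAtInfinity p α a) := by
  have hp := (differentiable_eval_snd p).continuous
  have hV : IsOpen {z : ℂ × ℂ | z.1 * p.eval z.2 - 1 ≠ 0} :=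
    isOpen_ne.preimage (by fun_prop : Continuous fun z : ℂ × ℂ => z.1 * p.eval z.2 - 1)
  have hη : ContinuousOn (fun z : ℂ × ℂ => (z.1 * (a * henonPole p z),
      z.1 * (a * z.2 * henonPole p z))) {z : ℂ × ℂ | z.1 * p.eval z.2 - 1 ≠ 0} := by
    have : ContinuousOn (henonPole p) {z : ℂ × ℂ | z.1 * p.eval z.2 - 1 ≠ 0} :=
      ContinuousOn.inv₀ (by fun_prop) fun z hz => hz
    fun_prop
  have h1 := ((isOpen_bottcherDomain α).preimage
    (by fun_prop : Continuous fun z : ℂ × ℂ => (z.1, z.1 * z.2))).inter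
    (hη.isOpen_inter_preimage hV (isOpen_bottcherDomain α))
  convert h1 using 1
  ext z
  exact mem_critDomainAtInfinity_iff hadm

theorem phiPlusInv_eq (hp : p.Monic) (hd : 2 ≤ p.natDegree) (hadm : HenonAdmissible p r R α)
    (ha : ‖a‖ ≤ R) (hz : z ∈ critDomainAtInfinity p α a) :
    phiPlusInv p a z = z.1 * Complex.exp (-bottcherLog p 1 a (z.1, z.1 * z.2)) := by
  by_cases hu : z.1 = 0
  · simp [phiPlusInv, hu]
  rw [phiPlusInv, if_neg hu, phiPlus_eq hp hd hadm ha (hz.resolve_left hu).1, mul_inv,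
    Complex.exp_neg]
  simp only [inv_inv, div_inv_eq_mul, mul_comm]

theorem phiMinusPowInv_eq (hp : p.Monic) (hd : 2 ≤ p.natDegree) (hadm : HenonAdmissible p r R α)
    (ha : ‖a‖ ≤ R) (hz : z ∈ critDomainAtInfinity p α a) :
    phiMinusPowInv p a z = z.1 * henonPole p z * Complex.exp (-bottcherLog p a 1
      (z.1 * (a * henonPole p z), z.1 * (a * z.2 * henonPole p z))) := by
  by_cases hu : z.1 = 0
  · simp [phiMinusPowInv, hu]
  rw [phiMinusPowInv, if_neg hu, phiMinusPow_zero_eq hp hd hadm ha (hz.resolve_left hu).2, mul_inv,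
    Complex.exp_neg]
  simp only [div_eq_mul_inv, inv_eval_sub p hu, mul_left_comm]

theorem exists_bottcherLog_eq_fst_mul (hp : p.Monic) (hd : 2 ≤ p.natDegree)
    (hadm : HenonAdmissible p r R α) {b c : ℂ} (hbc : ‖b‖ + ‖c‖ ≤ R + 1) :
    ∃ S : ℂ × ℂ → ℂ, DifferentiableOn ℂ S (bottcherDomain α) ∧
      ∀ w ∈ bottcherDomain α, bottcherLog p b c w = w.1 * S w :=
  exists_eq_fst_mul_of_differentiableOn (isOpen_bottcherDomain α)
    (differentiableOn_bottcherLog hp hd hadm hbc) fun w _ hw => by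
      obtain ⟨u, s⟩ := w
      obtain rfl : u = 0 := hw
      exact bottcherLog_zero hp hd b c s

/-- Here `s = u y`, so the whole line `u = 0` goes to the origin of the bidisc. Hence `A` is
constant there, which later forces `∂A/∂y = 0` on that line. -/
theorem exists_phiPlusInv_eq (hp : p.Monic) (hd : 2 ≤ p.natDegree)
    (hadm : HenonAdmissible p r R α) (ha : ‖a‖ ≤ R) :
    ∃ (A : ℂ × ℂ → ℂ) (c : ℂ), DifferentiableOn ℂ A (critDomainAtInfinity p α a) ∧
      (∀ y, A (0, y) = c) ∧ ∀ z ∈ critDomainAtInfinity p α a,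
        phiPlusInv p a z = z.1 * Complex.exp (-(z.1 * A z)) := by
  obtain ⟨S, hS, hSeq⟩ := exists_bottcherLog_eq_fst_mul hp hd hadm (b := 1) (c := a)
    (by simp; linarith)
  refine ⟨fun z => S (z.1, z.1 * z.2), S (0, 0), ?_, by simp, fun z hz => ?_⟩
  · exact hS.comp (f := fun z : ℂ × ℂ => (z.1, z.1 * z.2)) (by fun_prop) fun z hz =>
      ((mem_critDomainAtInfinity_iff hadm).1 hz).1
  · rw [phiPlusInv_eq hp hd hadm ha hz, hSeq _ ((mem_critDomainAtInfinity_iff hadm).1 hz).1]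

theorem exists_phiMinusPowInv_eq (hp : p.Monic) (hd : 2 ≤ p.natDegree)
    (hadm : HenonAdmissible p r R α) (ha : ‖a‖ ≤ R) :
    ∃ (B : ℂ × ℂ → ℂ) (c : ℂ), DifferentiableOn ℂ B (critDomainAtInfinity p α a) ∧
      (∀ y, B (0, y) = c) ∧ ∀ z ∈ critDomainAtInfinity p α a,
        phiMinusPowInv p a z = z.1 * (henonPole p z * Complex.exp (-(z.1 * B z))) := by
  obtain ⟨S, hS, hSeq⟩ := exists_bottcherLog_eq_fst_mul hp hd hadm (b := a) (c := 1)
    (by simp; linarith)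
  have hpole := differentiableOn_henonPole (a := a) hadm
  -- The constant on `u = 0` is `-a S(0, 0)` because the pole factor equals `-1` there.
  refine ⟨fun z => a * henonPole p z *
    S (z.1 * (a * henonPole p z), z.1 * (a * z.2 * henonPole p z)), -a * S (0, 0), ?_,
    by simp [henonPole], fun z hz => ?_⟩
  · refine DifferentiableOn.mul (by fun_prop) ?_
    exact hS.comp (f := fun z : ℂ × ℂ => (z.1 * (a * henonPole p z),
      z.1 * (a * z.2 * henonPole p z))) (by fun_prop) fun z hz =>
        ((mem_critDomainAtInfinity_iff hadm).1 hz).2.2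
  · rw [phiMinusPowInv_eq hp hd hadm ha hz, hSeq _ ((mem_critDomainAtInfinity_iff hadm).1 hz).2.2]
    simp only [mul_assoc]

end

/-! ### Wedge products and the inverse function theorem. -/

theorem HasFDerivAt.wedgeCoeff_eq {g₁ g₂ : ℂ × ℂ → ℂ} {L₁ L₂ : ℂ × ℂ →L[ℂ] ℂ} {z : ℂ × ℂ}
    (h₁ : HasFDerivAt g₁ L₁ z) (h₂ : HasFDerivAt g₂ L₂ z) :
    wedgeCoeff g₁ g₂ z = L₁ (1, 0) * L₂ (0, 1) - L₂ (1, 0) * L₁ (0, 1) := by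
  rw [wedgeCoeff, h₁.fderiv, h₂.fderiv]

theorem wedgeCoeff_congr {f₁ f₂ g₁ g₂ : ℂ × ℂ → ℂ} {z : ℂ × ℂ} (h₁ : f₁ =ᶠ[nhds z] g₁)
    (h₂ : f₂ =ᶠ[nhds z] g₂) : wedgeCoeff f₁ f₂ z = wedgeCoeff g₁ g₂ z := by
  simp only [wedgeCoeff, h₁.fderiv_eq, h₂.fderiv_eq]

/-- Composing with functions of one variable on the left and with `(x, y) ↦ (x⁻¹, y)` on the right
multiplies the wedge product by the derivatives. -/
theorem wedgeCoeff_comp_inv_fst {g₁ g₂ : ℂ × ℂ → ℂ} {h₁ h₂ : ℂ → ℂ} {h₁' h₂' : ℂ} {z : ℂ × ℂ}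
    (hz : z.1 ≠ 0) (hg₁ : DifferentiableAt ℂ g₁ (z.1⁻¹, z.2))
    (hg₂ : DifferentiableAt ℂ g₂ (z.1⁻¹, z.2))
    (hh₁ : HasDerivAt h₁ h₁' (g₁ (z.1⁻¹, z.2))) (hh₂ : HasDerivAt h₂ h₂' (g₂ (z.1⁻¹, z.2))) :
    wedgeCoeff (fun w => h₁ (g₁ (w.1⁻¹, w.2))) (fun w => h₂ (g₂ (w.1⁻¹, w.2))) z =
      -(h₁' * h₂' * (z.1 ^ 2)⁻¹ * wedgeCoeff g₁ g₂ (z.1⁻¹, z.2)) := by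
  have hκ : HasFDerivAt (fun w : ℂ × ℂ => (w.1⁻¹, w.2))
      (((-(z.1 ^ 2)⁻¹) • ContinuousLinearMap.fst ℂ ℂ ℂ).prod (ContinuousLinearMap.snd ℂ ℂ ℂ)) z :=
    ((hasDerivAt_inv hz).comp_hasFDerivAt z hasFDerivAt_fst).prodMk hasFDerivAt_snd
  refine ((hh₁.comp_hasFDerivAt z (hg₁.hasFDerivAt.comp z hκ)).wedgeCoeff_eq
    (hh₂.comp_hasFDerivAt z (hg₂.hasFDerivAt.comp z hκ))).trans ?_
  rw [wedgeCoeff]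
  have e1 : ∀ L : ℂ × ℂ →L[ℂ] ℂ, L (-(z.1 ^ 2)⁻¹, 0) = -(z.1 ^ 2)⁻¹ * L (1, 0) := fun L => by
    rw [← smul_eq_mul, ← map_smul]
    simp
  simp [e1]
  ring

/-- The product rule leaves `u (X Y_y - Y X_y)` as the only term with a single visible `u`;
divisibility of the `y`-derivatives supplies the second. -/
theorem wedgeCoeff_fst_mul {X Y P Q : ℂ × ℂ → ℂ} {z : ℂ × ℂ} (hX : DifferentiableAt ℂ X z)
    (hY : DifferentiableAt ℂ Y z) (hP : fderiv ℂ X z (0, 1) = z.1 * P z)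
    (hQ : fderiv ℂ Y z (0, 1) = z.1 * Q z) :
    wedgeCoeff (fun z => z.1 * X z) (fun z => z.1 * Y z) z =
      z.1 ^ 2 * (wedgeCoeff X Y z + X z * Q z - Y z * P z) := by
  refine ((hasFDerivAt_fst.mul hX.hasFDerivAt).wedgeCoeff_eq
    (hasFDerivAt_fst.mul hY.hasFDerivAt)).trans ?_
  simp [wedgeCoeff, hP, hQ]
  ring

theorem fderiv_apply_snd_eq_zero {B : ℂ × ℂ → ℂ} {u y c : ℂ} (hB : DifferentiableAt ℂ B (u, y))
    (hc : ∀ t, B (u, t) = c) : fderiv ℂ B (u, y) (0, 1) = 0 := by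
  have h1 : HasDerivAt (fun t => B (u, t)) (fderiv ℂ B (u, y) (0, 1)) y :=
    hB.hasFDerivAt.comp_hasDerivAt y ((hasDerivAt_const y u).prodMk (hasDerivAt_id y))
  simp only [hc] at h1
  exact h1.unique (hasDerivAt_const y c)

theorem DifferentiableOn.wedgeCoeff {U : Set (ℂ × ℂ)} (hU : IsOpen U) {g₁ g₂ : ℂ × ℂ → ℂ}
    (h₁ : DifferentiableOn ℂ g₁ U) (h₂ : DifferentiableOn ℂ g₂ U) :
    DifferentiableOn ℂ (wedgeCoeff g₁ g₂) U :=
  ((differentiableOn_fderiv_apply hU h₁ _).mul (differentiableOn_fderiv_apply hU h₂ _)).sub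
    ((differentiableOn_fderiv_apply hU h₂ _).mul (differentiableOn_fderiv_apply hU h₁ _))

theorem contDiffOn_one_of_differentiableOn {U : Set (ℂ × ℂ)} (hU : IsOpen U) {g : ℂ × ℂ → ℂ}
    (hg : DifferentiableOn ℂ g U) : ContDiffOn ℂ 1 g U := by
  rw [← zero_add (1 : WithTop ℕ∞), contDiffOn_succ_iff_fderiv_of_isOpen hU, contDiffOn_clm_apply]
  exact ⟨hg, by simp, fun v =>
    contDiffOn_zero.2 (differentiableOn_fderiv_apply hU hg v).continuousOn⟩

/-- The map `(g, w)` is a local coordinate system in which the zero set of `w` is `t ↦ (t, 0)`, with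
`t` the value of `g`. -/
theorem isLocalBiholomorphismOnAt_of_wedgeCoeff_ne_zero {U : Set (ℂ × ℂ)} (hU : IsOpen U)
    {g w : ℂ × ℂ → ℂ} (hg : DifferentiableOn ℂ g U) (hw : DifferentiableOn ℂ w U) {z₀ : ℂ × ℂ}
    (hz₀ : z₀ ∈ U) (hw₀ : w z₀ = 0) (h : wedgeCoeff g w z₀ ≠ 0) :
    IsLocalBiholomorphismOnAt g {z | z ∈ U ∧ w z = 0} z₀ := by
  refine ⟨⟨hz₀, hw₀⟩, ?_⟩
  have hUz := hU.mem_nhds hz₀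
  set Φ : ℂ × ℂ → ℂ × ℂ := fun z => (g z, w z) with hΦ
  have hcd : ContDiffAt ℂ 1 Φ z₀ := ((contDiffOn_one_of_differentiableOn hU hg).contDiffAt hUz).prodMk
    ((contDiffOn_one_of_differentiableOn hU hw).contDiffAt hUz)
  set L : ℂ × ℂ →L[ℂ] ℂ × ℂ := (fderiv ℂ g z₀).prod (fderiv ℂ w z₀) with hL
  have hLd : HasFDerivAt Φ L z₀ :=
    (hg.differentiableAt hUz).hasFDerivAt.prodMk (hw.differentiableAt hUz).hasFDerivAt
  have hinj : Function.Injective L := by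
    rw [injective_iff_map_eq_zero]
    rintro ⟨x, y⟩ hxy
    have hsplit : ∀ M : ℂ × ℂ →L[ℂ] ℂ, M (x, y) = x * M (1, 0) + y * M (0, 1) := fun M => by
      rw [← smul_eq_mul, ← smul_eq_mul, ← map_smul, ← map_smul, ← map_add]
      simp
    have h1 : fderiv ℂ g z₀ (x, y) = 0 := congrArg Prod.fst hxy
    have h2 : fderiv ℂ w z₀ (x, y) = 0 := congrArg Prod.snd hxy
    rw [hsplit] at h1 h2
    -- Cramer's rule: the wedge coefficient is the determinant of the differential.
    have hx : x * wedgeCoeff g w z₀ = 0 := by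
      rw [wedgeCoeff]
      linear_combination fderiv ℂ w z₀ (0, 1) * h1 - fderiv ℂ g z₀ (0, 1) * h2
    have hy : y * wedgeCoeff g w z₀ = 0 := by
      rw [wedgeCoeff]
      linear_combination fderiv ℂ g z₀ (1, 0) * h2 - fderiv ℂ w z₀ (1, 0) * h1
    exact Prod.ext ((mul_eq_zero.1 hx).resolve_right h) ((mul_eq_zero.1 hy).resolve_right h)
  set L' : (ℂ × ℂ) ≃L[ℂ] ℂ × ℂ := (LinearEquiv.ofInjectiveEndo
    (L : ℂ × ℂ →ₗ[ℂ] ℂ × ℂ) hinj).toContinuousLinearEquiv with hL'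
  have hLL' : (L' : ℂ × ℂ →L[ℂ] ℂ × ℂ) = L := by
    ext <;> rfl
  have hfd : HasFDerivAt Φ (L' : ℂ × ℂ →L[ℂ] ℂ × ℂ) z₀ := hLL' ▸ hLd
  have hinv := hcd.to_localInverse hfd one_ne_zero
  set e := hcd.toOpenPartialHomeomorph Φ hfd one_ne_zero with he
  have heΦ : ∀ z, e z = Φ z := fun z => rfl
  have hmem : z₀ ∈ e.source := hcd.mem_toOpenPartialHomeomorph_source hfd one_ne_zero
  -- The local inverse is known to be `C¹` only near the image point; `T` is an open set on which
  -- this holds.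
  obtain ⟨T, hTsub, hT, hzT⟩ := eventually_nhds_iff.1 (hinv.eventually (by simp))
  have hT' : IsOpen (e.target ∩ e.symm ⁻¹' U ∩ T) := (e.isOpen_inter_preimage_symm hU).inter hT
  refine ⟨e.source ∩ e ⁻¹' (e.target ∩ e.symm ⁻¹' U ∩ T),
    (fun t => (t, 0)) ⁻¹' (e.target ∩ e.symm ⁻¹' U ∩ T), fun t => e.symm (t, 0),
    e.isOpen_inter_preimage hT', ⟨hmem, ⟨e.map_source hmem, ?_⟩, hzT⟩,
    hT'.preimage (by fun_prop), ?_, ?_, ?_, ?_, ?_, ?_⟩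
  · simpa [e.left_inv hmem] using hz₀
  · refine hg.mono fun z hz => ?_
    simpa [e.left_inv hz.1] using hz.2.1.2
  · intro t ht
    have h1 : DifferentiableAt ℂ e.symm (t, 0) := (hTsub _ ht.2).differentiableAt one_ne_zero
    exact (h1.comp t (by fun_prop : DifferentiableAt ℂ (fun t : ℂ => (t, (0 : ℂ))) t))
      |>.differentiableWithinAt
  · rintro z ⟨⟨_, hz⟩, hzN⟩
    have : e z = (g z, 0) := by rw [heΦ, hΦ]; simp only [hz]
    rw [Set.mem_preimage, ← this]
    exact hzN.2
  · intro t ht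
    have h1 : Φ (e.symm (t, 0)) = (t, 0) := e.right_inv ht.1.1
    exact ⟨⟨ht.1.2, congrArg Prod.snd h1⟩, e.map_target ht.1.1, by
      rw [Set.mem_preimage, e.right_inv ht.1.1]; exact ht⟩
  · rintro z ⟨⟨_, hz⟩, hzN⟩
    have : e z = (g z, 0) := by rw [heΦ, hΦ]; simp only [hz]
    simp only [← this]
    exact e.left_inv hzN.1
  · intro t ht
    exact congrArg Prod.fst (e.right_inv ht.1.1)

/-! ### Factoring out `u`, comparison with the critical locus, and uniqueness. -/

section

variable {p : ℂ[X]} {r R α : ℝ} {a : ℂ}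

/-- `φ₊⁻¹ = u X` and `φ₋^{-d} = u Y`, where `∂X/∂y` and `∂Y/∂y` are divisible by `u`. -/
theorem exists_factorization (hp : p.Monic) (hd : 2 ≤ p.natDegree)
    (hadm : HenonAdmissible p r R α) (ha : ‖a‖ ≤ R) :
    ∃ X Y P Q : ℂ × ℂ → ℂ,
      (DifferentiableOn ℂ X (critDomainAtInfinity p α a) ∧
        DifferentiableOn ℂ Y (critDomainAtInfinity p α a) ∧
        DifferentiableOn ℂ P (critDomainAtInfinity p α a) ∧
        DifferentiableOn ℂ Q (critDomainAtInfinity p α a)) ∧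
      (∀ z ∈ critDomainAtInfinity p α a, X z ≠ 0 ∧ Y z ≠ 0 ∧
        phiPlusInv p a z = z.1 * X z ∧ phiMinusPowInv p a z = z.1 * Y z ∧
        fderiv ℂ X z (0, 1) = z.1 * P z ∧ fderiv ℂ Y z (0, 1) = z.1 * Q z) ∧
      ∀ y, X (0, y) = 1 ∧ P (0, y) = 0 ∧ Q (0, y) = -p.derivative.eval y := by
  obtain ⟨A, c, hA, hAc, hAeq⟩ := exists_phiPlusInv_eq hp hd hadm ha
  obtain ⟨B, c', hB, hBc, hBeq⟩ := exists_phiMinusPowInv_eq hp hd hadm ha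
  have hU := isOpen_critDomainAtInfinity (a := a) hadm
  have hpole := differentiableOn_henonPole (a := a) hadm
  have hA' := differentiableOn_fderiv_apply hU hA (0, 1)
  have hB' := differentiableOn_fderiv_apply hU hB (0, 1)
  have hp' := differentiable_eval_snd (derivative p)
  have hline : ∀ y, ((0, y) : ℂ × ℂ) ∈ critDomainAtInfinity p α a := fun y => Or.inl rfl
  refine ⟨fun z => Complex.exp (-(z.1 * A z)),
    fun z => henonPole p z * Complex.exp (-(z.1 * B z)),
    -- In `∂/∂y` each exponent `-u A`, `-u B` contributes a factor `u`, and so does the pole factor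
    -- `m`, since `∂m/∂y = -u p'(y) m²`.
    fun z => Complex.exp (-(z.1 * A z)) * -(fderiv ℂ A z (0, 1)),
    fun z => henonPole p z * Complex.exp (-(z.1 * B z)) *
      (-(fderiv ℂ B z (0, 1)) - p.derivative.eval z.2 * henonPole p z),
    ⟨by fun_prop, by fun_prop, by fun_prop, by fun_prop⟩, fun z hz => ?_, fun y => ?_⟩
  · have hne := ((mem_critDomainAtInfinity_iff hadm).1 hz).2.1
    have hAz := (hA.differentiableAt (hU.mem_nhds hz)).hasFDerivAt
    have hBz := (hB.differentiableAt (hU.mem_nhds hz)).hasFDerivAt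
    have hexp : ∀ {C : ℂ × ℂ → ℂ} {C' : ℂ × ℂ →L[ℂ] ℂ}, HasFDerivAt C C' z →
        HasFDerivAt (fun z => Complex.exp (-(z.1 * C z)))
          (Complex.exp (-(z.1 * C z)) • -(z.1 • C' + C z • ContinuousLinearMap.fst ℂ ℂ ℂ)) z :=
      fun hC => (hasFDerivAt_fst.mul hC).neg.cexp
    have hm : HasFDerivAt (henonPole p) (-(henonPole p z ^ 2) •
        (z.1 • (p.derivative.eval z.2 • ContinuousLinearMap.snd ℂ ℂ ℂ) +
          p.eval z.2 • ContinuousLinearMap.fst ℂ ℂ ℂ)) z := by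
      rw [henonPole, inv_pow]
      exact (hasDerivAt_inv hne).comp_hasFDerivAt z
        ((hasFDerivAt_fst.mul ((p.hasDerivAt z.2).comp_hasFDerivAt z hasFDerivAt_snd)).sub_const 1)
    refine ⟨Complex.exp_ne_zero _, mul_ne_zero (inv_ne_zero hne) (Complex.exp_ne_zero _),
      hAeq z hz, hBeq z hz, ?_, ?_⟩
    · rw [(hexp hAz).fderiv]
      simp
      ring
    · refine (congrArg (· (0, 1)) (hm.mul (hexp hBz)).fderiv).trans ?_
      simp
      ring
  · have h1 := fderiv_apply_snd_eq_zero (hA.differentiableAt (hU.mem_nhds (hline y))) hAc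
    have h2 := fderiv_apply_snd_eq_zero (hB.differentiableAt (hU.mem_nhds (hline y))) hBc
    simp [h1, h2, henonPole]

end

section

variable {p : ℂ[X]} {r R α : ℝ} {a : ℂ}

theorem hasDerivAt_inv_pow {t : ℂ} (ht : t ≠ 0) (N : ℕ) :
    HasDerivAt (fun t : ℂ => t⁻¹ ^ N) (N * t⁻¹ ^ (N - 1) * -(t ^ 2)⁻¹) t :=
  (hasDerivAt_inv ht).pow N

open Topology in
-- Near the point both continued functions are negative powers of `φ₊⁻¹` and `φ₋^{-d}`, so the chain
-- rule multiplies the wedge by nonzero factors. Tangency thus does not depend on `n` and `k`.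
theorem wedgeCoeff_iterate_eq_zero_iff (hp : p.Monic) (hd : 2 ≤ p.natDegree)
    (hadm : HenonAdmissible p r R α) (ha : ‖a‖ ≤ R) {z : ℂ × ℂ}
    (hz : z ∈ critDomainAtInfinity p α a) (hu : z.1 ≠ 0)
    (hA : DifferentiableAt ℂ (phiPlusInv p a) z) (hB : DifferentiableAt ℂ (phiMinusPowInv p a) z)
    (hA0 : phiPlusInv p a z ≠ 0) (hB0 : phiMinusPowInv p a z ≠ 0) (n k : ℕ) :
    wedgeCoeff (phiPlus p a ∘ (henon p a)^[n]) (phiMinusPow p a k) (z.1⁻¹, z.2) = 0 ↔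
      wedgeCoeff (phiPlusInv p a) (phiMinusPowInv p a) z = 0 := by
  have hd0 : p.natDegree ≠ 0 := by omega
  have hu' : z.1⁻¹ ≠ 0 := inv_ne_zero hu
  have hcont : ContinuousAt (fun v : ℂ × ℂ => (v.1⁻¹, v.2)) (z.1⁻¹, z.2) :=
    (continuousAt_fst.inv₀ hu').prodMk continuousAt_snd
  have hev : ∀ᶠ v : ℂ × ℂ in 𝓝 (z.1⁻¹, z.2),
      v.1 ≠ 0 ∧ v ∈ henonVPlus α ∧ v ∈ phiMinusPowDomain p α a 0 := by
    filter_upwards [continuousAt_fst.eventually_ne hu', hcont.preimage_mem_nhds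
      ((isOpen_critDomainAtInfinity (a := a) hadm).mem_nhds (by simpa using hz))] with v hv0 hv
    have := Or.resolve_left hv (inv_ne_zero hv0)
    simp only [inv_inv] at this
    exact ⟨hv0, this⟩
  have e1 : phiPlus p a ∘ (henon p a)^[n] =ᶠ[𝓝 (z.1⁻¹, z.2)]
      fun v => (phiPlusInv p a (v.1⁻¹, v.2))⁻¹ ^ p.natDegree ^ n := by
    filter_upwards [hev] with v hv
    rw [Function.comp_apply, phiPlus_henon_iterate hp hd hadm ha hv.2.1]
    simp [phiPlusInv, hv.1]
  have e2 : phiMinusPow p a k =ᶠ[𝓝 (z.1⁻¹, z.2)]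
      fun v => (phiMinusPowInv p a (v.1⁻¹, v.2))⁻¹ ^ p.natDegree ^ k := by
    filter_upwards [hev] with v hv
    rw [phiMinusPow_eq_pow hp hd hadm ha hv.2.2]
    simp [phiMinusPowInv, hv.1]
  have hzz : ((z.1⁻¹)⁻¹, z.2) = z := by rw [inv_inv]
  have key := wedgeCoeff_comp_inv_fst (z := (z.1⁻¹, z.2)) hu'
    (g₁ := phiPlusInv p a) (g₂ := phiMinusPowInv p a) (by rwa [hzz]) (by rwa [hzz])
    (hasDerivAt_inv_pow (by rwa [hzz]) (p.natDegree ^ n))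
    (hasDerivAt_inv_pow (by rwa [hzz]) (p.natDegree ^ k))
  rw [wedgeCoeff_congr e1 e2, key, hzz]
  simp [hu, hA0, hB0, hd0]

open Topology in
-- Dividing by `u²` determines the function off `u = 0`; continuity along horizontal slices
-- determines it on that line.
theorem eqOn_of_isCritDefiningFunction (hadm : HenonAdmissible p r R α) {w w' : ℂ × ℂ → ℂ}
    (hw : IsCritDefiningFunction p α a w) (hw' : IsCritDefiningFunction p α a w') :
    Set.EqOn w' w (critDomainAtInfinity p α a) := by
  have hU := isOpen_critDomainAtInfinity (a := a) hadm
  have hne : ∀ z ∈ critDomainAtInfinity p α a, z.1 ≠ 0 → w' z = w z := fun z hz hu =>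
    mul_left_cancel₀ (pow_ne_zero 2 hu) ((hw'.wedge_eq z hz).symm.trans (hw.wedge_eq z hz))
  rintro ⟨u, y⟩ hz
  by_cases hu : u = 0
  · subst hu
    have hcurve : Filter.Tendsto (fun t : ℂ => (t, y)) (𝓝[≠] 0) (𝓝 (0, y)) :=
      (Continuous.tendsto' (by fun_prop) _ _ rfl).mono_left nhdsWithin_le_nhds
    have h1 := (hw.holomorphic.differentiableAt (hU.mem_nhds hz)).continuousAt.tendsto.comp hcurve
    have h2 := (hw'.holomorphic.differentiableAt (hU.mem_nhds hz)).continuousAt.tendsto.comp hcurve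
    refine tendsto_nhds_unique (h2.congr' ?_) h1
    filter_upwards [hcurve.eventually (hU.mem_nhds hz), self_mem_nhdsWithin] with t ht ht0
    exact hne _ ht ht0
  · exact hne _ hz hu

end

/-! ### The extended critical locus at a simple critical point. -/

theorem mainTheorem6 (p : ℂ[X]) (hp : p.Monic) (hd : 2 ≤ p.natDegree) (r R α : ℝ)
    (hadm : HenonAdmissible p r R α) (a : ℂ) (ha : a ∈ Metric.ball (0 : ℂ) R) :
    ∃ w : ℂ × ℂ → ℂ, IsCritDefiningFunction p α a w ∧
      (∀ w' : ℂ × ℂ → ℂ, IsCritDefiningFunction p α a w' →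
        Set.EqOn w' w (critDomainAtInfinity p α a)) ∧
      (∀ z ∈ critDomainAtInfinity p α a, z.1 ≠ 0 →
        (z ∈ critZeroSet p α a w ↔ (z.1⁻¹, z.2) ∈ critLocus p α a)) ∧
      ∀ c : ℂ, p.derivative.eval c = 0 → p.derivative.derivative.eval c ≠ 0 →
        (∃ (N : Set (ℂ × ℂ)) (H : ℂ × ℂ → ℂ), IsOpen N ∧ ((0, c) : ℂ × ℂ) ∈ N ∧
          N ⊆ critDomainAtInfinity p α a ∧ DifferentiableOn ℂ H N ∧
          ∀ z ∈ N, w z = -p.derivative.eval z.2 - z.1 * H z) ∧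
        ((0, c) : ℂ × ℂ) ∈ critZeroSet p α a w ∧
        fderiv ℂ w (0, c) ≠ 0 ∧
        IsLocalBiholomorphismOnAt (phiPlusInv p a) (critZeroSet p α a w) (0, c) := by
  replace ha : ‖a‖ ≤ R := (mem_ball_zero_iff.1 ha).le
  have hU := isOpen_critDomainAtInfinity (a := a) hadm
  have hline : ∀ y, ((0, y) : ℂ × ℂ) ∈ critDomainAtInfinity p α a := fun y => Or.inl rfl
  obtain ⟨X, Y, P, Q, ⟨hX, hY, hP, hQ⟩, hfac, h0⟩ := exists_factorization hp hd hadm ha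
  have hA : DifferentiableOn ℂ (phiPlusInv p a) (critDomainAtInfinity p α a) :=
    (differentiable_fst.differentiableOn.mul hX).congr fun z hz => (hfac z hz).2.2.1
  have hB : DifferentiableOn ℂ (phiMinusPowInv p a) (critDomainAtInfinity p α a) :=
    (differentiable_fst.differentiableOn.mul hY).congr fun z hz => (hfac z hz).2.2.2.1
  set w : ℂ × ℂ → ℂ := fun z => wedgeCoeff X Y z + X z * Q z - Y z * P z with hwdef
  have hw : DifferentiableOn ℂ w (critDomainAtInfinity p α a) :=
    ((hX.wedgeCoeff hU hY).add (hX.mul hQ)).sub (hY.mul hP)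
  have hcrit : IsCritDefiningFunction p α a w := ⟨hw, fun z hz => by
    have hUz := hU.mem_nhds hz
    obtain ⟨-, -, -, -, hPz, hQz⟩ := hfac z hz
    rw [← wedgeCoeff_fst_mul (hX.differentiableAt hUz) (hY.differentiableAt hUz) hPz hQz]
    apply wedgeCoeff_congr
    · filter_upwards [hUz] with v hv using (hfac v hv).2.2.1
    · filter_upwards [hUz] with v hv using (hfac v hv).2.2.2.1⟩
  -- On `u = 0` both `y`-derivatives vanish, being divisible by `u`, and `P = 0`; only `X Q`
  -- survives.
  have hw0 : ∀ y, w (0, y) = -p.derivative.eval y := fun y => by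
    obtain ⟨hX0, hP0, hQ0⟩ := h0 y
    obtain ⟨-, -, -, -, hPz, hQz⟩ := hfac _ (hline y)
    simp [hwdef, wedgeCoeff, hX0, hP0, hQ0, hPz, hQz]
  refine ⟨w, hcrit, fun w' hw' => eqOn_of_isCritDefiningFunction hadm hcrit hw',
    fun z hz hu => ?_, fun c hc hc2 => ?_⟩
  · have hUz := hU.mem_nhds hz
    obtain ⟨hXz, hYz, hAz, hBz, -, -⟩ := hfac z hz
    have key := wedgeCoeff_iterate_eq_zero_iff hp hd hadm ha hz hu (hA.differentiableAt hUz)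
      (hB.differentiableAt hUz) (hAz ▸ mul_ne_zero hu hXz) (hBz ▸ mul_ne_zero hu hYz)
    have hwz : wedgeCoeff (phiPlusInv p a) (phiMinusPowInv p a) z = 0 ↔ w z = 0 := by
      rw [hcrit.wedge_eq z hz]
      simp [hu]
    constructor
    · rintro ⟨-, hz0⟩
      have hmem := hz.resolve_left hu
      exact ⟨0, 0, hmem.1, hmem.2, (key 0 0).2 (hwz.2 hz0)⟩
    · rintro ⟨n, k, -, -, h⟩
      exact ⟨hz, hwz.1 ((key n k).1 h)⟩
  · have hUc := hU.mem_nhds (hline c)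
    have hwc : w (0, c) = 0 := by rw [hw0, hc, neg_zero]
    have hwy : fderiv ℂ w (0, c) (0, 1) = -p.derivative.derivative.eval c := by
      have h1 : HasDerivAt (fun t => w (0, t)) (fderiv ℂ w (0, c) (0, 1)) c :=
        (hw.differentiableAt hUc).hasFDerivAt.comp_hasDerivAt c
          ((hasDerivAt_const c (0 : ℂ)).prodMk (hasDerivAt_id c))
      simp only [hw0] at h1
      exact h1.unique (p.derivative.hasDerivAt c).neg
    refine ⟨?_, ⟨hline c, hwc⟩, fun h => hc2 ?_, ?_⟩
    · obtain ⟨H, hH, hHeq⟩ := exists_eq_fst_mul_of_differentiableOn hU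
        (G := fun z => -p.derivative.eval z.2 - w z)
        ((differentiable_eval_snd _).neg.differentiableOn.sub hw) (by
          rintro ⟨u, y⟩ - hu
          obtain rfl : u = 0 := hu
          simp [hw0])
      -- The neighbourhood is the whole domain: the expansion holds globally, not just near `(0,
      -- c)`.
      refine ⟨_, H, hU, hline c, subset_rfl, hH, fun z hz => ?_⟩
      rw [← hHeq z hz]
      ring
    · rw [h] at hwy
      simpa using hwy.symm
    -- Since `dφ₊⁻¹ = du` at `(0, c)`, the wedge coefficient reduces to `∂w/∂y = -p''(c)`.
    · refine isLocalBiholomorphismOnAt_of_wedgeCoeff_ne_zero hU hA hw (hline c) hwc ?_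
      have hAy : fderiv ℂ (phiPlusInv p a) (0, c) (0, 1) = 0 :=
        fderiv_apply_snd_eq_zero (hA.differentiableAt hUc) (c := 0) fun t => if_pos rfl
      have hAu : fderiv ℂ (phiPlusInv p a) (0, c) (1, 0) = 1 := by
        have h1 : phiPlusInv p a =ᶠ[nhds (0, c)] fun z => z.1 * X z := by
          filter_upwards [hUc] with v hv using (hfac v hv).2.2.1
        rw [h1.fderiv_eq]
        refine (congrArg (· (1, 0))
          (hasFDerivAt_fst.mul (hX.differentiableAt hUc).hasFDerivAt).fderiv).trans ?_
        simp [(h0 c).1]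
      rw [wedgeCoeff, hAy, hAu, hwy]
      simpa using hc2
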